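/- For $x,y\in\{0,1\}^n$ let $x\vee y$ and $x\wedge y$ be the coordinatewise maximum and minimum. A function $f:\{0,1\}^n\to\mathbb R_+$ is monotone if $f(x)\le f(y)$ whenever $x\le y$ coordinatewise, and submodular if $f(x\vee y)+f(x\wedge y)\le f(x)+f(y)$ for all $x,y$. A function $h$ is a multiplicative $(\alpha,\epsilon)$-approximation of $f$ over the uniform distribution if $\Pr_{x}[f(x)\le h(x)\le\alpha f(x)]\ge 1-\epsilon$ for $x$ uniform in $\{0,1\}^n$. **Theorem 2.** There is an absolute constant $C>0$ such that the following holds; write $k(\gamma,\epsilon)=\frac{C}{\gamma^2}\log\frac{1}{\gamma\epsilon}\,\log\frac1\epsilon$. (1) For every $n$, every monotone submodular $f:\{0,1\}^n\to\mathbb R_+$ and all $\gamma,\epsilon\in(0,1)$ there are a set $J\subseteq[n]$ with $|J|\le k(\gamma,\epsilon)$ and a monotone submodular function $h:\{0,1\}^n\to\mathbb R_+$ that depends only on the variables in $J$ and is a multiplicative $(1+\gamma,\epsilon)$-approximation of $f$ over the uniform distribution. (2) Such $J$ and $h$ can be found with high probability using $\mathrm{poly}(n)$ value queries to $f$: for every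 $d\in\mathbb N$ there is a polynomial $p$ such that for all $n$ and all $\gamma,\epsilon\in(0,1)$ some randomized adaptive algorithm makes at most $p(n)$ value queries and, for every monotone submodular $f:\{0,1\}^n\to\mathbb R_+$, with probability at least $1-(n+1)^{-d}$ outputs a set $J$ and a deterministic procedure that computes each value $h(x)$ by at most $p(n)$ value queries to $f$, where $J$ and $h$ are as in (1). (3) For fixed $\gamma,\epsilon$ the function $h$ can be output explicitly: for every $d\in\mathbb N$ there is a polynomial $p$ such that for all $\gamma,\epsilon\in(0,1)$ there is a number $K=K(\gamma,\epsilon)$ such that for every $n$ some randomized adaptive algorithm makes at most $K\,p(n)$ value queries and, for every monotone submodular $f:\{0,1\}^n\to\mathbb R_+$, with probability at least $1-(n+1)^{-d}$ outputs $J$ and $h$ as in (1). -/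

import Mathlib

/-- The Boolean cube `{0,1}^n`, ordered coordinatewise with `false < true`. Under the
identification of points with subsets of `[n]`, `x ≤ y` is inclusion, `x ⊔ y` is the union and
`x ⊓ y` the intersection. -/
abbrev Cube (n : ℕ) : Type := Fin n → Bool

/-- Submodularity: `f (A ∪ B) + f (A ∩ B) ≤ f A + f B`. -/
def IsSubmodular {n : ℕ} (f : Cube n → ℝ) : Prop :=
  ∀ x y : Cube n, f (x ⊔ y) + f (x ⊓ y) ≤ f x + f y

/-- Nonnegative monotone submodular functions `{0,1}^n → ℝ₊`. -/
structure IsMonotoneSubmodular {n : ℕ} (f : Cube n → ℝ) : Prop where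
  nonneg : ∀ x, 0 ≤ f x
  monotone : Monotone f
  submodular : IsSubmodular f

open Classical in
/-- The probability of an event under the uniform distribution on `{0,1}^n`. -/
noncomputable def uniformProb {n : ℕ} (P : Cube n → Prop) : ℝ :=
  ((Finset.univ.filter P).card : ℝ) / (2 : ℝ) ^ n

/-- `h` is a multiplicative `(α, ε)`-approximation of `f` over the uniform distribution. -/
def IsMultApprox {n : ℕ} (α ε : ℝ) (f h : Cube n → ℝ) : Prop :=
  1 - ε ≤ uniformProb (fun x => f x ≤ h x ∧ h x ≤ α * f x)

/-- `h` is a monotone submodular function that depends only on the variables in `J`, where `J` has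
at most `k` elements, and `h` is a multiplicative `(1 + γ, ε)`-approximation of `f`. -/
structure IsJuntaApprox {n : ℕ} (f : Cube n → ℝ) (γ ε k : ℝ) (J : Finset (Fin n))
    (h : Cube n → ℝ) : Prop where
  card_le : (J.card : ℝ) ≤ k
  monotoneSubmodular : IsMonotoneSubmodular h
  dependsOn : DependsOn h (J : Set (Fin n))
  approx : IsMultApprox (1 + γ) ε f h

/-- Deterministic adaptive value-query algorithms for real functions on `{0,1}^n`, with results in
`α`: either stop with a result, or query the value at a point and continue depending on the
answer. The target function is accessible only through the queries. -/
inductive QueryAlg (n : ℕ) (α : Type) : Type where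
  | done (a : α) : QueryAlg n α
  | query (x : Cube n) (next : ℝ → QueryAlg n α) : QueryAlg n α

namespace QueryAlg

/-- The result of an algorithm when the queries are answered by `f`. -/
def run {n : ℕ} {α : Type} (f : Cube n → ℝ) : QueryAlg n α → α
  | done a => a
  | query x next => (next (f x)).run f

/-- The number of queries made when they are answered by `f`. -/
def numQueries {n : ℕ} {α : Type} (f : Cube n → ℝ) : QueryAlg n α → ℕ
  | done _ => 0
  | query x next => (next (f x)).numQueries f + 1

/-- The algorithm makes at most `q` queries, whatever the function it is run on. -/
def QueriesAtMost {n : ℕ} {α : Type} (A : QueryAlg n α) (q : ℕ) : Prop :=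
  ∀ f : Cube n → ℝ, A.numQueries f ≤ q

end QueryAlg

/-- Randomized value-query algorithms: a random choice of a deterministic one, made before any
query is answered. -/
abbrev RandQueryAlg (n : ℕ) (α : Type) : Type := PMF (QueryAlg n α)

namespace RandQueryAlg

/-- Every outcome of the random choices makes at most `q` queries. -/
def QueriesAtMost {n : ℕ} {α : Type} (A : RandQueryAlg n α) (q : ℕ) : Prop :=
  ∀ D ∈ PMF.support A, D.QueriesAtMost q

/-- The probability, over the random choices of `A`, that the result of `A` run on `f` lies in the
set `G`. -/
noncomputable def successProb {n : ℕ} {α : Type} (A : RandQueryAlg n α) (f : Cube n → ℝ)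
    (G : Set α) : ENNReal :=
  PMF.toOuterMeasure A {D | D.run f ∈ G}

end RandQueryAlg

/-- A succinct description of a function of the variables in a set: the set of variables, and for
every point a deterministic procedure that computes the value at that point by value queries to
the target. -/
abbrev OracleJunta (n : ℕ) : Type := Finset (Fin n) × (Cube n → QueryAlg n ℝ)

/-- An explicit description of such a function: the set of variables and the function itself. -/
abbrev ExplicitJunta (n : ℕ) : Type := Finset (Fin n) × (Cube n → ℝ)

/-- The bound `C · γ⁻² · log (1 / (γ ε)) · log (1 / ε)`. -/
noncomputable def juntaSize (C γ ε : ℝ) : ℝ :=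
  C * (1 / γ ^ 2) * Real.log (1 / (γ * ε)) * Real.log (1 / ε)

/-!
Juntas for monotone submodular functions, and learning them by value queries.

Fix a threshold `α`, of order `γ² / log (1 / ε)`, and call `i` *big* at a set `x` if adding it
multiplies `f` by more than `1 + α`. Bigness is a decreasing event in `x` by diminishing marginal
values (`Big.anti`). The junta is supported on the set `J` of the coordinates that are big with
constant probability at a random set of the low density `1 / (4 k)`, where `k` is of order
`log (1 / (γ ε))`.

* In any set at most `1 + 1 / α` elements are big, since their marginal values sum up to at most
  the value of the set. Hence `J` has `O(k / α)` elements (`sum_P_big_le`, `card_influential_le`).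
* The union of `k` sparse random sets is still sparser than density `1 - √(1/2)`, so the probability
  of a decreasing event drops to its `k`-th power. Only the bound on the sum of the probabilities
  enters the union bound, so that with high probability no coordinate outside `J` is big
  at a random set of this density, independently of the dimension (`P_exists_big_le`).
* A monotone submodular function with small marginal values is concentrated around its mean: adding
  one coordinate at a time and using Harris' inequality, its moment generating function is dominated
  by that of a Poisson variable (`E_exp_le`).
* A uniform set is the union of two independent sets of density `1 - √(1/2)`. Exchanging these one
  at a time, outside `J`, keeps in place a set at which no coordinate outside `J` is big,
  and changes the value by little. Hence `f x` and `f (splice J x z)` agree up to a factor close to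
  `1` for most pairs `x`, `z` (`P_not_close_splice_le`, `exists_influential_params`).

So the function `x ↦ s * f (splice J x z)`, with a fixed random `z` and a scale `s`, is an
approximating junta, computed by one query per value. The set `J` is found by sampling to constant
accuracy (`P_not_isInfluentialSet_le`). If `ε` is smaller than a suitable inverse polynomial in `n`,
one random `z` succeeds with high probability (`learnable_of_sample`). Otherwise several `z` are
drawn and compared on random test points (`learnable_of_test`). For `ε` close to `1` the size
bound allows only a coarser approximation, and it is refined by trying all scales, one of
which succeeds with probability at least `1 - ε`; the coarsest one is the constant `f ⊤`
(`learnable_of_test_const`). If `1 - ε` is too small for testing, then it is also so small that a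
random constant succeeds (`learnable_of_const`), unless the size bound exceeds `n` and `f` itself is
admissible (`learnable_of_le`). The existence of the junta follows from the positive success
probability, and the explicit form by tabulating the procedure on the subsets of `J`.
-/

/-! ### Finite probability spaces -/

/-- The number `1` if `p` holds and `0` otherwise. -/
noncomputable def ind (p : Prop) : ℝ := by
  classical exact if p then 1 else 0

theorem ind_of_true {p : Prop} (h : p) : ind p = 1 := by simp [ind, h]

theorem ind_of_false {p : Prop} (h : ¬ p) : ind p = 0 := by simp [ind, h]

theorem ind_nonneg (p : Prop) : 0 ≤ ind p := by
  unfold ind; split_ifs <;> norm_num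

theorem ind_le_one (p : Prop) : ind p ≤ 1 := by
  unfold ind; split_ifs <;> norm_num

theorem ind_le_ind {p q : Prop} (h : p → q) : ind p ≤ ind q := by
  by_cases hp : p
  · rw [ind_of_true hp, ind_of_true (h hp)]
  · rw [ind_of_false hp]; exact ind_nonneg q

/-- A probability distribution on a finite type, given by real weights. -/
structure FinProb (Ω : Type*) [Fintype Ω] where
  /-- The weight of an outcome. -/
  w : Ω → ℝ
  nonneg : ∀ a, 0 ≤ w a
  sum_w : ∑ a, w a = 1

namespace FinProb

variable {Ω Ω' : Type*} [Fintype Ω] [Fintype Ω'] (μ : FinProb Ω) (ν : FinProb Ω')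

/-- Expectation. -/
noncomputable def E (φ : Ω → ℝ) : ℝ := ∑ a, μ.w a * φ a

/-- Probability of an event. -/
noncomputable def P (S : Ω → Prop) : ℝ := μ.E fun a => ind (S a)

theorem E_mono {φ ψ : Ω → ℝ} (h : ∀ a, φ a ≤ ψ a) : μ.E φ ≤ μ.E ψ :=
  Finset.sum_le_sum fun a _ => mul_le_mul_of_nonneg_left (h a) (μ.nonneg a)

theorem E_const (c : ℝ) : μ.E (fun _ => c) = c := by
  simp [E, ← Finset.sum_mul, μ.sum_w]

theorem E_add (φ ψ : Ω → ℝ) : μ.E (fun a => φ a + ψ a) = μ.E φ + μ.E ψ := by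
  simp [E, mul_add, Finset.sum_add_distrib]

theorem E_sub (φ ψ : Ω → ℝ) : μ.E (fun a => φ a - ψ a) = μ.E φ - μ.E ψ := by
  simp [E, mul_sub, Finset.sum_sub_distrib]

theorem E_mul_left (c : ℝ) (φ : Ω → ℝ) : μ.E (fun a => c * φ a) = c * μ.E φ := by
  simp only [E, Finset.mul_sum]
  exact Finset.sum_congr rfl fun a _ => by ring

theorem E_mul_right (c : ℝ) (φ : Ω → ℝ) : μ.E (fun a => φ a * c) = μ.E φ * c := by
  simp only [E, Finset.sum_mul]
  exact Finset.sum_congr rfl fun a _ => by ring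

theorem E_sum {ι : Type*} (s : Finset ι) (φ : ι → Ω → ℝ) :
    μ.E (fun a => ∑ i ∈ s, φ i a) = ∑ i ∈ s, μ.E (φ i) := by
  simp only [E, Finset.mul_sum]
  exact Finset.sum_comm

theorem E_nonneg {φ : Ω → ℝ} (h : ∀ a, 0 ≤ φ a) : 0 ≤ μ.E φ :=
  Finset.sum_nonneg fun a _ => mul_nonneg (μ.nonneg a) (h a)

theorem E_le_const {φ : Ω → ℝ} {c : ℝ} (h : ∀ a, φ a ≤ c) : μ.E φ ≤ c :=
  (μ.E_mono h).trans (μ.E_const c).le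

theorem const_le_E {φ : Ω → ℝ} {c : ℝ} (h : ∀ a, c ≤ φ a) : c ≤ μ.E φ :=
  (μ.E_const c).symm.le.trans (μ.E_mono h)

theorem E_comm (φ : Ω → Ω' → ℝ) :
    μ.E (fun a => ν.E fun b => φ a b) = ν.E fun b => μ.E fun a => φ a b := by
  simp only [E, Finset.mul_sum]
  rw [Finset.sum_comm]
  exact Finset.sum_congr rfl fun a _ => Finset.sum_congr rfl fun b _ => by ring

theorem P_nonneg (S : Ω → Prop) : 0 ≤ μ.P S := μ.E_nonneg fun _ => ind_nonneg _

theorem P_le_one (S : Ω → Prop) : μ.P S ≤ 1 := μ.E_le_const fun _ => ind_le_one _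

theorem P_mono {S T : Ω → Prop} (h : ∀ a, S a → T a) : μ.P S ≤ μ.P T :=
  μ.E_mono fun a => ind_le_ind (h a)

theorem P_compl (S : Ω → Prop) : μ.P (fun a => ¬ S a) = 1 - μ.P S := by
  rw [← μ.E_const 1, P, P, ← E_sub]
  congr 1
  funext a
  by_cases h : S a <;> simp [ind, h]

theorem P_or_le (S T : Ω → Prop) : μ.P (fun a => S a ∨ T a) ≤ μ.P S + μ.P T := by
  rw [P, P, P, ← E_add]
  refine μ.E_mono fun a => ?_
  by_cases h : S a <;> by_cases h' : T a <;> simp [ind, h, h']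

theorem P_exists_le {ι : Type*} (s : Finset ι) (S : ι → Ω → Prop) :
    μ.P (fun a => ∃ i ∈ s, S i a) ≤ ∑ i ∈ s, μ.P (S i) := by
  unfold P
  rw [← E_sum]
  refine μ.E_mono fun a => ?_
  by_cases h : ∃ i ∈ s, S i a
  · obtain ⟨i, hi, hS⟩ := h
    refine (ind_le_one _).trans ?_
    rw [← ind_of_true hS]
    exact Finset.single_le_sum (f := fun j => ind (S j a)) (fun j _ => ind_nonneg _) hi
  · rw [ind_of_false h]
    exact Finset.sum_nonneg fun j _ => ind_nonneg _

/-- Markov's inequality. -/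
theorem mul_P_le_E {φ : Ω → ℝ} (h : ∀ a, 0 ≤ φ a) (t : ℝ) :
    t * μ.P (fun a => t ≤ φ a) ≤ μ.E φ := by
  rw [P, ← E_mul_left]
  refine μ.E_mono fun a => ?_
  by_cases ha : t ≤ φ a
  · simpa [ind_of_true ha] using ha
  · simpa [ind_of_false ha] using h a

/-- The product of two distributions. -/
noncomputable def prod : FinProb (Ω × Ω') where
  w z := μ.w z.1 * ν.w z.2
  nonneg z := mul_nonneg (μ.nonneg _) (ν.nonneg _)
  sum_w := by
    rw [Fintype.sum_prod_type]
    simp [← Finset.mul_sum, μ.sum_w, ν.sum_w]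

theorem E_prod (φ : Ω × Ω' → ℝ) : (μ.prod ν).E φ = μ.E fun a => ν.E fun b => φ (a, b) := by
  simp only [E, prod, Fintype.sum_prod_type, Finset.mul_sum]
  exact Finset.sum_congr rfl fun a _ => Finset.sum_congr rfl fun b _ => by ring

theorem P_prod (S : Ω × Ω' → Prop) :
    (μ.prod ν).P S = μ.E fun a => ν.P fun b => S (a, b) := E_prod _ _ _

/-- If the first component is bad with probability at most `s`, and for every good first component
the second one is bad with probability at most `t`, then the pair is bad with probability at most
`s + t`. -/
theorem P_prod_le {S : Ω → Prop} {T : Ω × Ω' → Prop} {s t : ℝ} (hs : μ.P S ≤ s) (ht : 0 ≤ t)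
    (h : ∀ a, ¬ S a → ν.P (fun b => T (a, b)) ≤ t) : (μ.prod ν).P T ≤ s + t := by
  rw [P_prod]
  calc μ.E (fun a => ν.P fun b => T (a, b)) ≤ μ.E (fun a => ind (S a) + t) := by
        refine μ.E_mono fun a => ?_
        by_cases ha : S a
        · rw [ind_of_true ha]
          exact (ν.P_le_one _).trans (by linarith)
        · have := h a ha
          have := ind_nonneg (S a)
          linarith
    _ = μ.P S + t := by rw [E_add, E_const, P]
    _ ≤ s + t := by linarith

section Pi

variable {ι A B : Type*} [Fintype ι] [DecidableEq ι] [Fintype A] [Fintype B]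

/-- The distribution of a vector with independent coordinates. -/
noncomputable def pi (μ : ι → FinProb A) : FinProb (ι → A) where
  w x := ∏ i, (μ i).w (x i)
  nonneg x := Finset.prod_nonneg fun i _ => (μ i).nonneg _
  sum_w := by
    have := Finset.prod_univ_sum (fun _ : ι => (Finset.univ : Finset A)) (fun i a => (μ i).w a)
    rw [Fintype.piFinset_univ] at this
    rw [← this]
    simp [(μ _).sum_w]

/-- A coordinatewise map sends a product distribution to the product of the image distributions;
that `ν i` is the image of `μ i` is expressed by expectations. -/
theorem E_pi_map (μ : ι → FinProb A) (ν : ι → FinProb B) (c : ι → A → B)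
    (h : ∀ i ψ, (μ i).E (fun a => ψ (c i a)) = (ν i).E ψ) (φ : (ι → B) → ℝ) :
    (pi μ).E (fun x => φ fun i => c i (x i)) = (pi ν).E φ := by
  classical
  have hν : ∀ i b, (ν i).w b = ∑ a, (μ i).w a * (if c i a = b then 1 else 0) := by
    intro i b
    have := h i (fun b' => if b' = b then 1 else 0)
    simp only [E] at this
    rw [this]
    simp
  have hw : ∀ y : ι → B, (pi ν).w y
      = ∑ x, (pi μ).w x * (if (fun i => c i (x i)) = y then 1 else 0) := by
    intro y
    simp only [pi, hν]
    rw [Finset.prod_univ_sum, Fintype.piFinset_univ]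
    refine Finset.sum_congr rfl fun x _ => ?_
    rw [Finset.prod_mul_distrib]
    congr 1
    rw [Finset.prod_ite_zero]
    simp [funext_iff]
  simp only [E, hw, Finset.sum_mul]
  rw [Finset.sum_comm]
  refine Finset.sum_congr rfl fun x _ => ?_
  simp

theorem E_pi_pair (μ : ι → FinProb A) (ν : ι → FinProb B) (φ : (ι → A) → (ι → B) → ℝ) :
    (pi fun i => (μ i).prod (ν i)).E (fun z => φ (fun i => (z i).1) fun i => (z i).2)
      = (pi μ).E fun x => (pi ν).E fun y => φ x y := by
  rw [← E_prod (pi μ) (pi ν) fun z => φ z.1 z.2]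
  refine Fintype.sum_equiv (Equiv.arrowProdEquivProdArrow ι (fun _ => A) (fun _ => B)) _ _
    fun z => ?_
  simp [pi, prod, Finset.prod_mul_distrib, Equiv.arrowProdEquivProdArrow]

/-- A coordinatewise map of two independent vectors. -/
theorem E_pi_map₂ {D : Type*} [Fintype D] (μ : ι → FinProb A) (ν : ι → FinProb B)
    (κ : ι → FinProb D) (c : ι → A → B → D)
    (h : ∀ i ψ, (μ i).E (fun a => (ν i).E fun b => ψ (c i a b)) = (κ i).E ψ)
    (φ : (ι → D) → ℝ) :
    (pi μ).E (fun x => (pi ν).E fun y => φ fun i => c i (x i) (y i)) = (pi κ).E φ := by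
  rw [← E_pi_pair μ ν fun x y => φ fun i => c i (x i) (y i)]
  exact E_pi_map (fun i => (μ i).prod (ν i)) κ (fun i z => c i z.1 z.2)
    (fun i ψ => by rw [E_prod]; exact h i ψ) φ

theorem E_pi_eval (μ : ι → FinProb A) (i : ι) (ψ : A → ℝ) :
    (pi μ).E (fun x => ψ (x i)) = (μ i).E ψ := by
  have := Finset.prod_univ_sum (fun _ : ι => (Finset.univ : Finset A))
    (fun j a => (μ j).w a * if j = i then ψ a else 1)
  rw [Fintype.piFinset_univ] at this
  simp only [Finset.prod_mul_distrib, Finset.prod_ite_eq', Finset.mem_univ, if_true] at this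
  unfold E
  refine this.symm.trans ?_
  rw [← Finset.mul_prod_erase _ _ (Finset.mem_univ i)]
  rw [Finset.prod_eq_one]
  · simp
  · intro j hj
    simp [Finset.ne_of_mem_erase hj, (μ j).sum_w]

/-- The distribution of `m` independent samples of `μ`. -/
noncomputable def iid (μ : FinProb A) (m : ℕ) : FinProb (Fin m → A) := pi fun _ => μ

theorem E_iid_succ (μ : FinProb A) (m : ℕ) (φ : (Fin (m + 1) → A) → ℝ) :
    (iid μ (m + 1)).E φ = μ.E fun a => (iid μ m).E fun x => φ (Fin.cons a x) := by
  rw [← E_prod μ (iid μ m) fun z => φ (Fin.cons z.1 z.2)]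
  refine (Fintype.sum_equiv (Fin.consEquiv fun _ => A) _ _ fun z => ?_).symm
  simp [iid, pi, prod, Fin.consEquiv, Fin.prod_univ_succ]

theorem E_iid_zero (μ : FinProb A) (φ : (Fin 0 → A) → ℝ) :
    (iid μ 0).E φ = φ Fin.elim0 := by
  have : φ = fun _ => φ Fin.elim0 := by
    funext x; congr 1; exact Subsingleton.elim _ _
  rw [this, E_const]

theorem P_iid_forall (μ : FinProb A) (S : A → Prop) (m : ℕ) :
    (iid μ m).P (fun x => ∀ r, S (x r)) = μ.P S ^ m := by
  induction m with
  | zero => rw [P, E_iid_zero, ind_of_true (fun r => r.elim0), pow_zero]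
  | succ m ih =>
    rw [P, E_iid_succ]
    have : ∀ a, (iid μ m).E (fun x => ind (∀ r, S ((Fin.cons a x : Fin (m + 1) → A) r)))
        = ind (S a) * μ.P S ^ m := by
      intro a
      rw [← ih, P, ← E_mul_left]
      congr 1
      funext x
      rw [show (∀ r, S ((Fin.cons a x : Fin (m + 1) → A) r)) ↔ (S a ∧ ∀ r, S (x r)) by
        rw [Fin.forall_fin_succ]; simp]
      by_cases h : S a <;> by_cases h' : ∀ r, S (x r) <;> simp [ind, h, h']
    simp only [this]
    rw [E_mul_right, pow_succ']
    rfl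

theorem E_iid_sum_sq (μ : FinProb A) (ψ : A → ℝ) (h0 : μ.E ψ = 0) (m : ℕ) :
    (iid μ m).E (fun x => ∑ r, ψ (x r)) = 0 ∧
      (iid μ m).E (fun x => (∑ r, ψ (x r)) ^ 2) = m * μ.E fun a => ψ a ^ 2 := by
  induction m with
  | zero => simp [E_iid_zero]
  | succ m ih =>
    rw [E_iid_succ, E_iid_succ]
    simp only [Fin.sum_univ_succ, Fin.cons_zero, Fin.cons_succ]
    have h1 : ∀ a, (iid μ m).E (fun x => ψ a + ∑ r, ψ (x r)) = ψ a := by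
      intro a; rw [E_add, E_const, ih.1, add_zero]
    have h2 : ∀ a, (iid μ m).E (fun x => (ψ a + ∑ r, ψ (x r)) ^ 2)
        = ψ a ^ 2 + m * μ.E fun a => ψ a ^ 2 := by
      intro a
      rw [← ih.2, ← add_zero (ψ a ^ 2), ← mul_zero (2 * ψ a), ← ih.1, ← E_mul_left,
        ← (iid μ m).E_const (ψ a ^ 2), ← E_add, ← E_add]
      congr 1
      funext x
      ring
    simp only [h1, h2]
    refine ⟨h0, ?_⟩
    rw [E_add, E_const]
    push_cast
    ring

/-- Chebyshev's inequality for the empirical frequency of an event in `m` independent samples. -/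
theorem P_empirical_le (μ : FinProb A) (S : A → Prop) {m : ℕ} (hm : 0 < m) {t : ℝ} (ht : 0 < t) :
    (iid μ m).P (fun x => t ≤ |(∑ r, ind (S (x r))) / m - μ.P S|) ≤ 1 / (m * t ^ 2) := by
  have hm' : (0 : ℝ) < m := by exact_mod_cast hm
  have hP0 := μ.P_nonneg S
  have hP1 := μ.P_le_one S
  have h0 : μ.E (fun a => ind (S a) - μ.P S) = 0 := by
    rw [E_sub, E_const, P, sub_self]
  have hsq : μ.E (fun a => (ind (S a) - μ.P S) ^ 2) ≤ 1 := by
    refine μ.E_le_const fun a => ?_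
    have := ind_nonneg (S a)
    have := ind_le_one (S a)
    nlinarith
  have hm2 := (E_iid_sum_sq μ _ h0 m).2
  have hmar := (iid μ m).mul_P_le_E
    (φ := fun x => (∑ r, (ind (S (x r)) - μ.P S)) ^ 2) (fun x => sq_nonneg _) ((m * t) ^ 2)
  have hle : (iid μ m).P (fun x => t ≤ |(∑ r, ind (S (x r))) / m - μ.P S|)
      ≤ (iid μ m).P (fun x => (m * t) ^ 2 ≤ (∑ r, (ind (S (x r)) - μ.P S)) ^ 2) := by
    refine P_mono _ fun x hx => ?_
    have h1 : ∑ r, (ind (S (x r)) - μ.P S) = (m : ℝ) * ((∑ r, ind (S (x r))) / m - μ.P S) := by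
      rw [Finset.sum_sub_distrib]
      field_simp
      simp
    rw [h1, mul_pow, mul_pow]
    exact mul_le_mul_of_nonneg_left (sq_le_sq.2 (by rwa [abs_of_pos ht])) (by positivity)
  rw [hm2] at hmar
  have h3 : (m * t) ^ 2 * (iid μ m).P (fun x => t ≤ |(∑ r, ind (S (x r))) / m - μ.P S|) ≤ m :=
    (mul_le_mul_of_nonneg_left hle (by positivity)).trans
      (hmar.trans (by nlinarith))
  rw [le_div_iff₀ (by positivity)]
  have : m * ((iid μ m).P (fun x => t ≤ |(∑ r, ind (S (x r))) / m - μ.P S|) * (m * t ^ 2))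
      ≤ m * 1 := by
    calc _ = (m * t) ^ 2 * (iid μ m).P (fun x => t ≤ |(∑ r, ind (S (x r))) / m - μ.P S|) := by
          ring
      _ ≤ _ := by linarith
  exact le_of_mul_le_mul_left this hm'

end Pi

/-- The same distribution as a probability mass function. -/
noncomputable def toPMF : PMF Ω :=
  PMF.ofFintype (fun a => ENNReal.ofReal (μ.w a)) (by
    rw [← ENNReal.ofReal_sum_of_nonneg fun a _ => μ.nonneg a, μ.sum_w, ENNReal.ofReal_one])

theorem toOuterMeasure_toPMF (S : Ω → Prop) :
    μ.toPMF.toOuterMeasure {a | S a} = ENNReal.ofReal (μ.P S) := by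
  classical
  rw [PMF.toOuterMeasure_apply_fintype, P, E, ENNReal.ofReal_sum_of_nonneg fun a _ =>
    mul_nonneg (μ.nonneg a) (ind_nonneg _)]
  refine Finset.sum_congr rfl fun a _ => ?_
  by_cases h : S a
  · simp [h, ind_of_true, toPMF]
  · simp [h, ind_of_false]

end FinProb

/-! ### Product distributions on the cube -/

open FinProb

/-- The distribution of a bit that is `true` with probability `p`. -/
noncomputable def bern (p : unitInterval) : FinProb Bool where
  w b := if b then (p : ℝ) else 1 - p
  nonneg b := by
    have := p.2.1
    have := p.2.2
    cases b <;> simp <;> linarith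
  sum_w := by simp

theorem E_bern (p : unitInterval) (ψ : Bool → ℝ) :
    (bern p).E ψ = (1 - (p : ℝ)) * ψ false + p * ψ true := by
  simp [bern, E, add_comm]

/-- The distribution of a random subset of `[n]` that contains every element independently with
probability `p`. -/
noncomputable def cube (n : ℕ) (p : unitInterval) : FinProb (Cube n) := pi fun _ => bern p

/-- The density `1 / 2`. -/
noncomputable def halfI : unitInterval := ⟨1 / 2, by norm_num, by norm_num⟩

theorem uniformProb_eq {n : ℕ} (S : Cube n → Prop) : uniformProb S = (cube n halfI).P S := by
  classical
  have hw : ∀ x : Cube n, (cube n halfI).w x = 1 / 2 ^ n := by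
    intro x
    have : ∀ b : Bool, (bern halfI).w b = 1 / 2 := by
      intro b; cases b <;> norm_num [bern, halfI]
    simp [cube, pi, this]
  unfold P E uniformProb
  simp only [hw, ← Finset.mul_sum]
  rw [Finset.card_filter]
  push_cast
  rw [div_eq_mul_inv, mul_comm, one_div]
  congr 1

/-- The density of the union of two independent random sets of densities `p` and `q`. -/
noncomputable def supI (p q : unitInterval) : unitInterval :=
  unitInterval.symm (unitInterval.symm p * unitInterval.symm q)

theorem coe_supI (p q : unitInterval) : (supI p q : ℝ) = 1 - (1 - p) * (1 - q) := by
  simp [supI]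

theorem E_cube_sup {n : ℕ} (p q : unitInterval) (φ : Cube n → ℝ) :
    (cube n p).E (fun x => (cube n q).E fun y => φ (x ⊔ y)) = (cube n (supI p q)).E φ := by
  refine E_pi_map₂ (fun _ => bern p) (fun _ => bern q) (fun _ => bern (supI p q))
    (fun _ a b => a ⊔ b) (fun i ψ => ?_) φ
  simp only [E_bern, coe_supI]
  simp
  ring

/-- The indicator vector of a set of coordinates. -/
def chi {n : ℕ} (J : Finset (Fin n)) : Cube n := fun i => decide (i ∈ J)

/-- The point that agrees with `x` on `J` and with `y` outside `J`. -/
def splice {n : ℕ} (J : Finset (Fin n)) (x y : Cube n) : Cube n :=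
  fun i => if i ∈ J then x i else y i

theorem E_cube_splice {n : ℕ} (p : unitInterval) (J : Finset (Fin n)) (φ : Cube n → ℝ) :
    (cube n p).E (fun x => (cube n p).E fun y => φ (splice J x y)) = (cube n p).E φ := by
  refine E_pi_map₂ (fun _ => bern p) (fun _ => bern p) (fun _ => bern p)
    (fun i a b => if i ∈ J then a else b) (fun i ψ => ?_) φ
  by_cases h : i ∈ J <;> simp [h, E_const]

theorem E_cube_update {n : ℕ} (p : unitInterval) (i : Fin n) (φ : Cube n → ℝ) :
    (cube n p).E φ = (1 - (p : ℝ)) * (cube n p).E (fun x => φ (Function.update x i false))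
      + p * (cube n p).E (fun x => φ (Function.update x i true)) := by
  rw [← E_cube_splice p {i} φ, E_comm, ← E_mul_left, ← E_mul_left, ← E_add]
  congr 1
  funext y
  rw [← E_bern p fun b => φ (Function.update y i b)]
  rw [← E_pi_eval (fun _ : Fin n => bern p) i]
  unfold cube
  congr 1
  funext x
  congr 1
  funext j
  by_cases h : j = i
  · subst h; simp [splice]
  · simp [splice, h]

/-! ### Decreasing events -/

/-- A decreasing event loses probability like a power when independent random sets are united. -/
theorem P_cube_supI_le {n : ℕ} (p q : unitInterval) {S : Cube n → Prop}
    (hS : ∀ x y, x ≤ y → S y → S x) :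
    (cube n (supI p q)).P S ≤ (cube n p).P S * (cube n q).P S := by
  rw [P, ← E_cube_sup, P, ← E_mul_right]
  refine E_mono _ fun x => ?_
  rw [P, ← E_mul_left]
  refine E_mono _ fun y => ?_
  by_cases h : S (x ⊔ y)
  · rw [ind_of_true h, ind_of_true (hS _ _ le_sup_left h), ind_of_true (hS _ _ le_sup_right h),
      mul_one]
  · rw [ind_of_false h]
    exact mul_nonneg (ind_nonneg _) (ind_nonneg _)

theorem P_cube_anti {n : ℕ} {p q : unitInterval} (hpq : p ≤ q) {S : Cube n → Prop}
    (hS : ∀ x y, x ≤ y → S y → S x) : (cube n q).P S ≤ (cube n p).P S := by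
  obtain ⟨r, hr⟩ : ∃ r, supI p r = q := by
    have hp := p.2.2
    have hq := q.2.2
    have hpq' : (p : ℝ) ≤ q := hpq
    rcases hp.lt_or_eq with hp1 | hp1
    · refine ⟨⟨1 - (1 - q) / (1 - p), ?_, ?_⟩, ?_⟩
      · rw [sub_nonneg, div_le_one (by linarith)]; linarith
      · have : 0 ≤ (1 - (q : ℝ)) / (1 - p) := div_nonneg (by linarith) (by linarith)
        linarith
      · apply Subtype.ext
        rw [coe_supI]
        have : 1 - (p : ℝ) ≠ 0 := by linarith
        simp only
        field_simp
        ring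
    · refine ⟨0, Subtype.ext ?_⟩
      rw [coe_supI]
      simp
      linarith
  rw [← hr]
  refine (P_cube_supI_le p r hS).trans ?_
  have := P_le_one (cube n r) S
  have := P_nonneg (cube n p) S
  nlinarith

/-- Boosting: if `k` independent copies of a random set of density `q` have a union of density at
most `p`, then a decreasing event has probability at most its `k`-th power under density `p`. -/
theorem P_cube_le_pow {n : ℕ} {p q : unitInterval} {k : ℕ} (h : 1 - (p : ℝ) ≤ (1 - q) ^ k)
    {S : Cube n → Prop} (hS : ∀ x y, x ≤ y → S y → S x) :
    (cube n p).P S ≤ (cube n q).P S ^ k := by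
  have key : ∀ k : ℕ, (cube n (unitInterval.symm (unitInterval.symm q ^ k))).P S
      ≤ (cube n q).P S ^ k := by
    intro k
    induction k with
    | zero => rw [pow_zero, pow_zero]; exact P_le_one _ _
    | succ k ih =>
      have : unitInterval.symm (unitInterval.symm q ^ (k + 1))
          = supI (unitInterval.symm (unitInterval.symm q ^ k)) q := by
        simp [supI, pow_succ]
      rw [this, pow_succ]
      exact (P_cube_supI_le _ _ hS).trans
        (mul_le_mul_of_nonneg_right ih (P_nonneg _ _))
  refine le_trans (P_cube_anti ?_ hS) (key k)
  rw [← Subtype.coe_le_coe]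
  simp
  linarith

/-- Harris' inequality: an increasing and a decreasing function are negatively correlated. -/
theorem E_cube_mul_le {n : ℕ} (p : unitInterval) {φ ψ : Cube n → ℝ} {c : ℝ} (hφ0 : ∀ x, 0 ≤ φ x)
    (hψc : ∀ x, ψ x ≤ c) (hφ : Monotone φ) (hψ : Antitone ψ) :
    (cube n p).E (fun x => φ x * ψ x) ≤ (cube n p).E φ * (cube n p).E ψ := by
  have hμ : ∀ a b : Cube n, (cube n p).w a * (cube n p).w b
      ≤ (cube n p).w (a ⊓ b) * (cube n p).w (a ⊔ b) := by
    intro a b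
    refine le_of_eq ?_
    simp only [cube, pi, ← Finset.prod_mul_distrib]
    refine Finset.prod_congr rfl fun i _ => ?_
    simp only [Pi.inf_apply, Pi.sup_apply]
    cases a i <;> cases b i <;> simp [mul_comm]
  have h := fkg (μ := (cube n p).w) (f := φ) (g := fun x => c - ψ x) (fun x => (cube n p).nonneg x)
    hφ0 (fun x => sub_nonneg.2 (hψc x)) hφ (fun x y hxy => sub_le_sub_left (hψ hxy) c) hμ
  rw [(cube n p).sum_w, one_mul] at h
  have h1 : ∑ a, (cube n p).w a * (c - ψ a) = c - (cube n p).E ψ := by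
    have := (cube n p).E_sub (fun _ => c) ψ
    rwa [E_const] at this
  have h2 : ∑ a, (cube n p).w a * (φ a * (c - ψ a))
      = (cube n p).E φ * c - (cube n p).E fun x => φ x * ψ x := by
    rw [← E_mul_right, ← E_sub]
    unfold E
    refine Finset.sum_congr rfl fun x _ => ?_
    ring
  rw [h1, h2] at h
  change (cube n p).E φ * _ ≤ _ at h
  linarith

/-! ### Concentration of monotone submodular functions -/

theorem update_inf_chi_insert {n : ℕ} (x : Cube n) {i : Fin n} {T : Finset (Fin n)}
    (b : Bool) :
    Function.update x i b ⊓ chi (insert i T) = Function.update (x ⊓ chi T) i b := by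
  funext j
  by_cases h : j = i
  · subst h; simp [chi]
  · simp [chi, h]

theorem inf_chi_update_of_notMem {n : ℕ} (x : Cube n) {i : Fin n} {T : Finset (Fin n)}
    (h : i ∉ T) : Function.update (x ⊓ chi T) i false = x ⊓ chi T := by
  rw [Function.update_eq_self_iff]
  simp [chi, h]

theorem inf_chi_univ {n : ℕ} (x : Cube n) : x ⊓ chi Finset.univ = x := by
  funext j; simp [chi]

theorem update_false_le_update_true {n : ℕ} (x : Cube n) (i : Fin n) :
    Function.update x i false ≤ Function.update x i true :=
  update_le_update_iff.2 ⟨by decide, fun _ _ => le_rfl⟩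

theorem update_mono {n : ℕ} {x y : Cube n} (h : x ≤ y) (i : Fin n) (b : Bool) :
    Function.update x i b ≤ Function.update y i b :=
  update_le_update_iff.2 ⟨le_rfl, fun j _ => h j⟩

/-- Diminishing marginal values. -/
theorem IsSubmodular.marginal_anti {n : ℕ} {f : Cube n → ℝ} (hf : IsSubmodular f) {x y : Cube n}
    (h : x ≤ y) (i : Fin n) :
    f (Function.update y i true) - f (Function.update y i false)
      ≤ f (Function.update x i true) - f (Function.update x i false) := by
  have h1 : Function.update x i true ⊔ Function.update y i false = Function.update y i true := by
    funext j
    by_cases hj : j = i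
    · subst hj; simp
    · have := h j
      revert this
      cases hx : x j <;> cases hy : y j <;> simp [hj, hx, hy]
  have h2 : Function.update x i true ⊓ Function.update y i false = Function.update x i false := by
    funext j
    by_cases hj : j = i
    · subst hj; simp
    · have := h j
      revert this
      cases hx : x j <;> cases hy : y j <;> simp [hj, hx, hy]
  have := hf (Function.update x i true) (Function.update y i false)
  rw [h1, h2] at this
  linarith

theorem exp_mul_le_one_add {l d : ℝ} (h0 : 0 ≤ d) (h1 : d ≤ 1) :
    Real.exp (l * d) ≤ 1 + (Real.exp l - 1) * d := by
  have := convexOn_exp.2 (Set.mem_univ 0) (Set.mem_univ l) (sub_nonneg.2 h1) h0 (by ring)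
  simp only [smul_eq_mul, mul_zero, zero_add, Real.exp_zero, mul_one] at this
  rw [mul_comm l d]
  linarith

/-- The moment generating function of a monotone submodular function with marginal values at most
`1` is dominated by that of a Poisson variable of the same mean. Adding one coordinate at a time
multiplies the exponential by a factor that depends on the marginal value of the coordinate, and
diminishing marginal values make the two factors negatively correlated. -/
theorem E_exp_le {n : ℕ} {G : Cube n → ℝ} (hG : IsMonotoneSubmodular G)
    (h1 : ∀ x i, G (Function.update x i true) - G (Function.update x i false) ≤ 1)
    (p : unitInterval) (l : ℝ) :
    (cube n p).E (fun x => Real.exp (l * G x))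
      ≤ Real.exp ((Real.exp l - 1) * (cube n p).E G) := by
  have hp0 := p.2.1
  have hp1 := p.2.2
  suffices H : ∀ T : Finset (Fin n), (cube n p).E (fun x => Real.exp (l * G (x ⊓ chi T)))
      ≤ Real.exp ((Real.exp l - 1) * (cube n p).E fun x => G (x ⊓ chi T)) by
    simpa only [inf_chi_univ] using H Finset.univ
  intro T
  induction T using Finset.induction_on with
  | empty =>
    have : ∀ x : Cube n, x ⊓ chi ∅ = ⊥ := fun x => by funext j; simp [chi]
    simp only [this, E_const]
    refine Real.exp_le_exp.2 (mul_le_mul_of_nonneg_right ?_ (hG.nonneg _))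
    have := Real.add_one_le_exp l
    linarith
  | insert i T hi ih =>
    set d : Cube n → ℝ := fun x => G (Function.update (x ⊓ chi T) i true) - G (x ⊓ chi T) with hd
    have hd0 : ∀ x, 0 ≤ d x := by
      intro x
      have := hG.monotone (update_false_le_update_true (x ⊓ chi T) i)
      rw [inf_chi_update_of_notMem x hi] at this
      exact sub_nonneg.2 this
    have hd1 : ∀ x, d x ≤ 1 := by
      intro x
      have := h1 (x ⊓ chi T) i
      rwa [inf_chi_update_of_notMem x hi] at this
    have hanti : Antitone d := by
      intro x y hxy
      have := hG.submodular.marginal_anti (inf_le_inf_right (chi T) hxy) i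
      rwa [inf_chi_update_of_notMem x hi, inf_chi_update_of_notMem y hi] at this
    have hmono : Monotone fun x : Cube n => G (x ⊓ chi T) :=
      fun x y hxy => hG.monotone (inf_le_inf_right (chi T) hxy)
    have hup : ∀ x, G (Function.update (x ⊓ chi T) i true) = G (x ⊓ chi T) + d x := by
      intro x; simp [hd]
    have hE : (cube n p).E (fun x => G (x ⊓ chi (insert i T)))
        = (cube n p).E (fun x => G (x ⊓ chi T)) + p * (cube n p).E d := by
      rw [E_cube_update p i]
      simp only [update_inf_chi_insert, inf_chi_update_of_notMem _ hi, hup]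
      rw [E_add]
      ring
    have hexp : (cube n p).E (fun x => Real.exp (l * G (x ⊓ chi (insert i T))))
        = (cube n p).E (fun x => Real.exp (l * G (x ⊓ chi T))
            * (1 - p + p * Real.exp (l * d x))) := by
      rw [E_cube_update p i]
      simp only [update_inf_chi_insert, inf_chi_update_of_notMem _ hi, hup]
      rw [← E_mul_left, ← E_mul_left, ← E_add]
      congr 1
      funext x
      rw [mul_add, Real.exp_add]
      ring
    have hcorr : (cube n p).E (fun x => Real.exp (l * G (x ⊓ chi T))
            * (1 - p + p * Real.exp (l * d x)))
        ≤ (cube n p).E (fun x => Real.exp (l * G (x ⊓ chi T)))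
          * (cube n p).E (fun x => 1 - p + p * Real.exp (l * d x)) := by
      rcases le_total 0 l with hl | hl
      · refine E_cube_mul_le p (c := 1 - p + p * Real.exp l) (fun x => (Real.exp_pos _).le)
          (fun x => ?_) (fun x y hxy => ?_) (fun x y hxy => ?_)
        · have : l * d x ≤ l := by nlinarith [hd1 x]
          have := mul_le_mul_of_nonneg_left (Real.exp_le_exp.2 this) hp0
          linarith
        · exact Real.exp_le_exp.2 (mul_le_mul_of_nonneg_left (hmono hxy) hl)
        · have := mul_le_mul_of_nonneg_left
            (Real.exp_le_exp.2 (mul_le_mul_of_nonneg_left (hanti hxy) hl)) hp0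
          linarith
      · have := E_cube_mul_le p (φ := fun x => 1 - p + p * Real.exp (l * d x))
          (ψ := fun x => Real.exp (l * G (x ⊓ chi T))) (c := 1) (fun x => ?_) (fun x => ?_)
          (fun x y hxy => ?_) (fun x y hxy => ?_)
        · simp only [mul_comm] at this ⊢
          exact this
        · have := mul_nonneg hp0 (Real.exp_pos (l * d x)).le
          linarith
        · rw [← Real.exp_zero]
          exact Real.exp_le_exp.2 (mul_nonpos_of_nonpos_of_nonneg hl (hG.nonneg _))
        · have := mul_le_mul_of_nonneg_left
            (Real.exp_le_exp.2 (mul_le_mul_of_nonpos_left (hanti hxy) hl)) hp0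
          simp only
          linarith
        · exact Real.exp_le_exp.2 (mul_le_mul_of_nonpos_left (hmono hxy) hl)
    have hfac : (cube n p).E (fun x => 1 - p + p * Real.exp (l * d x))
        ≤ Real.exp ((Real.exp l - 1) * (p * (cube n p).E d)) := by
      calc (cube n p).E (fun x => 1 - p + p * Real.exp (l * d x))
          ≤ (cube n p).E (fun x => 1 + (Real.exp l - 1) * p * d x) := by
            refine E_mono _ fun x => ?_
            have := mul_le_mul_of_nonneg_left (exp_mul_le_one_add (l := l) (hd0 x) (hd1 x)) hp0
            linarith
        _ = (Real.exp l - 1) * (p * (cube n p).E d) + 1 := by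
            rw [E_add, E_const, E_mul_left]; ring
        _ ≤ _ := Real.add_one_le_exp _
    rw [hexp, hE, mul_add, Real.exp_add]
    refine hcorr.trans ?_
    refine mul_le_mul ih hfac ?_ (Real.exp_pos _).le
    exact E_nonneg _ fun x => by
      have := mul_nonneg hp0 (Real.exp_pos (l * d x)).le
      linarith

/-- Exponential tail bound around the mean `m` for a function whose moment generating function is
dominated by the Poisson one. -/
theorem P_abs_sub_ge_le {Ω : Type*} [Fintype Ω] (μ : FinProb Ω) {X : Ω → ℝ} {m : ℝ}
    (hm : 0 ≤ m) (h : ∀ l, μ.E (fun x => Real.exp (l * X x)) ≤ Real.exp ((Real.exp l - 1) * m))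
    {δ : ℝ} (h0 : 0 ≤ δ) (h2 : δ ≤ 2) :
    μ.P (fun x => δ * m ≤ |X x - m|) ≤ 2 * Real.exp (-(δ ^ 2 * m / 4)) := by
  have key : ∀ l, |l| ≤ 1 → μ.E (fun x => Real.exp (l * (X x - m))) ≤ Real.exp (m * l ^ 2) := by
    intro l hl
    have h3 := (abs_le.1 (Real.abs_exp_sub_one_sub_id_le hl)).2
    have h4 : ∀ x, Real.exp (l * (X x - m)) = Real.exp (l * X x) * Real.exp (-(l * m)) := by
      intro x; rw [← Real.exp_add]; ring_nf
    simp only [h4]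
    rw [E_mul_right]
    refine (mul_le_mul_of_nonneg_right (h l) (Real.exp_pos _).le).trans ?_
    rw [← Real.exp_add]
    refine Real.exp_le_exp.2 ?_
    nlinarith
  have side : ∀ s : ℝ, |s| = 1 →
      μ.P (fun x => δ * m ≤ s * (X x - m)) ≤ Real.exp (-(δ ^ 2 * m / 4)) := by
    intro s hs
    have hs2 : s ^ 2 = 1 := by rw [← sq_abs, hs, one_pow]
    have hk := key (s * (δ / 2)) (by
      rw [abs_mul, hs, one_mul, abs_of_nonneg (by linarith)]; linarith)
    have hmar := μ.mul_P_le_E (φ := fun x => Real.exp (s * (δ / 2) * (X x - m)))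
      (fun x => (Real.exp_pos _).le) (Real.exp (δ ^ 2 / 2 * m))
    have hsub : μ.P (fun x => δ * m ≤ s * (X x - m))
        ≤ μ.P (fun x => Real.exp (δ ^ 2 / 2 * m) ≤ Real.exp (s * (δ / 2) * (X x - m))) := by
      refine P_mono _ fun x hx => Real.exp_le_exp.2 ?_
      nlinarith
    have h5 : Real.exp (δ ^ 2 / 2 * m) * μ.P (fun x => δ * m ≤ s * (X x - m))
        ≤ Real.exp (m * (s * (δ / 2)) ^ 2) :=
      (mul_le_mul_of_nonneg_left hsub (Real.exp_pos _).le).trans (hmar.trans hk)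
    have h6 : Real.exp (-(δ ^ 2 * m / 4))
        = Real.exp (m * (s * (δ / 2)) ^ 2) / Real.exp (δ ^ 2 / 2 * m) := by
      rw [← Real.exp_sub, mul_pow, hs2]; ring_nf
    rw [h6, le_div_iff₀ (Real.exp_pos _), mul_comm]
    exact h5
  have hor := μ.P_or_le (fun x => δ * m ≤ 1 * (X x - m)) (fun x => δ * m ≤ (-1) * (X x - m))
  have h7 := side 1 (by simp)
  have h8 := side (-1) (by simp)
  have h9 : μ.P (fun x => δ * m ≤ |X x - m|)
      ≤ μ.P (fun x => δ * m ≤ 1 * (X x - m) ∨ δ * m ≤ (-1) * (X x - m)) := by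
    refine P_mono _ fun x hx => ?_
    rcases le_abs.1 hx with h | h
    · left; linarith
    · right; linarith
  linarith

/-- `A` and `B` agree up to a factor `t`. -/
def Close (t A B : ℝ) : Prop := A ≤ t * B ∧ B ≤ t * A

theorem Close.trans {t A B C : ℝ} (ht : 0 ≤ t) (h : Close t A B) (h' : Close t B C) :
    Close (t ^ 2) A C := by
  refine ⟨?_, ?_⟩
  · nlinarith [mul_le_mul_of_nonneg_left h'.1 ht, h.1]
  · nlinarith [mul_le_mul_of_nonneg_left h.2 ht, h'.2]

/-- If all elements have a marginal value of at most `α g(∅)`, then the values of `g` at two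
independent random sets agree up to a factor `t` with high probability. -/
theorem P_not_close_le {n : ℕ} {g : Cube n → ℝ} (hg : IsMonotoneSubmodular g) {α δ t : ℝ}
    (hα : 0 < α) (hm : ∀ i, g (Function.update ⊥ i true) ≤ (1 + α) * g ⊥)
    (h0 : 0 ≤ δ) (h2 : δ ≤ 1) (ht : 1 ≤ t) (hδt : 1 + δ ≤ t * (1 - δ)) (p : unitInterval) :
    (cube n p).E (fun y => (cube n p).P fun y' => ¬ Close t (g y) (g y'))
      ≤ 4 * Real.exp (-(δ ^ 2 / (4 * α))) := by
  have hmarg : ∀ x i, g (Function.update x i true) - g (Function.update x i false)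
      ≤ α * g ⊥ := by
    intro x i
    have := hg.submodular.marginal_anti (bot_le : ⊥ ≤ x) i
    have h' : Function.update (⊥ : Cube n) i false = ⊥ := by
      rw [Function.update_eq_self_iff]; rfl
    rw [h'] at this
    linarith [hm i]
  rcases (hg.nonneg ⊥).lt_or_eq with hpos | hzero
  · set a := α * g ⊥ with ha
    have ha0 : 0 < a := mul_pos hα hpos
    set X : Cube n → ℝ := fun x => g x / a with hX
    have hXms : IsMonotoneSubmodular X := by
      refine ⟨fun x => div_nonneg (hg.nonneg x) ha0.le, fun x y hxy => ?_, fun x y => ?_⟩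
      · exact div_le_div_of_nonneg_right (hg.monotone hxy) ha0.le
      · simp only [hX, ← add_div]
        exact div_le_div_of_nonneg_right (hg.submodular x y) ha0.le
    have hX1 : ∀ x i, X (Function.update x i true) - X (Function.update x i false) ≤ 1 := by
      intro x i
      simp only [hX, ← sub_div]
      rw [div_le_one ha0]
      exact hmarg x i
    have hmean : 1 / α ≤ (cube n p).E X := by
      refine const_le_E _ fun x => ?_
      simp only [hX, ha]
      rw [div_le_div_iff₀ hα (mul_pos hα hpos), one_mul]
      have := hg.monotone (bot_le : ⊥ ≤ x)
      nlinarith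
    set m := (cube n p).E X with hmdef
    have hm0 : 0 < m := lt_of_lt_of_le (by positivity) hmean
    have htail := P_abs_sub_ge_le (cube n p) hm0.le (fun l => E_exp_le hXms hX1 p l) h0
      (by linarith : δ ≤ 2)
    have htail' : (cube n p).P (fun x => δ * m ≤ |X x - m|)
        ≤ 2 * Real.exp (-(δ ^ 2 / (4 * α))) := by
      refine htail.trans ?_
      have : δ ^ 2 / (4 * α) ≤ δ ^ 2 * m / 4 := by
        have := mul_le_mul_of_nonneg_left hmean (sq_nonneg δ)
        calc δ ^ 2 / (4 * α) = δ ^ 2 * (1 / α) / 4 := by field_simp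
          _ ≤ _ := by linarith
      have := Real.exp_le_exp.2 (neg_le_neg this)
      linarith
    have hclose : ∀ y y', ¬ Close t (g y) (g y') →
        (δ * m ≤ |X y - m|) ∨ (δ * m ≤ |X y' - m|) := by
      intro y y' hc
      by_contra! hcon
      refine hc ?_
      have h3 := abs_lt.1 hcon.1
      have h4 := abs_lt.1 hcon.2
      have h5 : ∀ z, g z = a * X z := fun z => by simp only [hX]; field_simp
      have aux : ∀ A B : ℝ, A < (1 + δ) * m → (1 - δ) * m < B → A ≤ t * B := by
        intro A B hA hB
        nlinarith [mul_le_mul_of_nonneg_right hδt hm0.le]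
      refine ⟨?_, ?_⟩
      · rw [h5, h5, mul_left_comm]
        exact mul_le_mul_of_nonneg_left (aux _ _ (by linarith) (by linarith)) ha0.le
      · rw [h5, h5, mul_left_comm]
        exact mul_le_mul_of_nonneg_left (aux _ _ (by linarith) (by linarith)) ha0.le
    calc (cube n p).E (fun y => (cube n p).P fun y' => ¬ Close t (g y) (g y'))
        ≤ (cube n p).E (fun y => ind (δ * m ≤ |X y - m|)
            + (cube n p).P fun y' => δ * m ≤ |X y' - m|) := by
          refine E_mono _ fun y => ?_
          by_cases hy : δ * m ≤ |X y - m|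
          · rw [ind_of_true hy]
            have := P_le_one (cube n p) fun y' => ¬ Close t (g y) (g y')
            have := P_nonneg (cube n p) fun y' => δ * m ≤ |X y' - m|
            linarith
          · rw [ind_of_false hy, zero_add]
            exact P_mono _ fun y' h => (hclose y y' h).resolve_left hy
      _ = (cube n p).P (fun y => δ * m ≤ |X y - m|)
            + (cube n p).P (fun y' => δ * m ≤ |X y' - m|) := by
          rw [E_add, E_const]; rfl
      _ ≤ _ := by linarith
  · have hconst : ∀ x, g x = 0 := by
      intro x
      have H : ∀ T : Finset (Fin n), g (x ⊓ chi T) = 0 := by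
        intro T
        induction T using Finset.induction_on with
        | empty =>
          have : x ⊓ chi ∅ = ⊥ := by funext j; simp [chi]
          rw [this, ← hzero]
        | insert i T hi ih =>
          have h3 := hmarg (x ⊓ chi T) i
          rw [inf_chi_update_of_notMem x hi, ih, ← hzero] at h3
          have h4 : x ⊓ chi (insert i T) ≤ Function.update (x ⊓ chi T) i true := by
            rw [← update_inf_chi_insert]
            refine inf_le_inf_right _ (le_update_iff.2 ⟨?_, fun _ _ => le_rfl⟩)
            exact le_top
          have h5 := hg.monotone h4
          have h6 := hg.nonneg (x ⊓ chi (insert i T))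
          linarith
      rw [← inf_chi_univ x]
      exact H _
    have : ∀ y, (cube n p).P (fun y' => ¬ Close t (g y) (g y')) = 0 := by
      intro y
      have hc : ∀ y', ¬ ¬ Close t (g y) (g y') := by
        intro y'
        simp [Close, hconst]
      simp only [P, ind_of_false (hc _), E_const]
    simp only [this, E_const]
    positivity

/-! ### Influential coordinates -/

/-- Adding `i` to the set `x` increases the value of `f` by more than the factor `1 + α`. -/
def Big {n : ℕ} (f : Cube n → ℝ) (α : ℝ) (i : Fin n) (x : Cube n) : Prop :=
  (1 + α) * f (Function.update x i false) < f (Function.update x i true)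

theorem Big.anti {n : ℕ} {f : Cube n → ℝ} (hf : IsMonotoneSubmodular f) {α : ℝ} (hα : 0 ≤ α)
    {i : Fin n} {x y : Cube n} (h : x ≤ y) (hy : Big f α i y) : Big f α i x := by
  have h1 := hf.submodular.marginal_anti h i
  have h2 := hf.monotone (update_mono h i false)
  unfold Big at hy ⊢
  nlinarith

/-- The marginal values of the elements of a set sum up to at most the value of the set. -/
theorem sum_marginal_le {n : ℕ} {f : Cube n → ℝ} (hf : IsMonotoneSubmodular f) (x : Cube n) :
    ∑ i, (f x - f (Function.update x i false)) ≤ f x := by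
  suffices H : ∀ T : Finset (Fin n),
      ∑ i ∈ T, (f x - f (Function.update x i false)) ≤ f x - f (x \ chi T) by
    have := H Finset.univ
    have := hf.nonneg (x \ chi Finset.univ)
    linarith
  intro T
  induction T using Finset.induction_on with
  | empty =>
    have : x \ chi ∅ = x := by
      funext j; cases h : x j
      · simp [chi, h]
      · simp [chi, h]; exact disjoint_bot_right
    simp [this]
  | insert i T hi ih =>
    rw [Finset.sum_insert hi]
    have h1 : x \ chi T ⊔ Function.update x i false = x := by
      funext j
      by_cases hj : j = i
      · subst hj; cases h : x j
        · simp [chi, hi, h]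
        · simp [chi, hi, h]; exact disjoint_bot_right
      · by_cases hjT : j ∈ T <;> simp [hj, chi, hjT]
    have h2 : x \ chi T ⊓ Function.update x i false = x \ chi (insert i T) := by
      funext j
      by_cases hj : j = i
      · subst hj; cases h : x j
        · simp [chi, hi, h]; exact disjoint_bot_left
        · simp [chi, h]
      · by_cases hjT : j ∈ T <;> simp [hj, chi, hjT]
    have := hf.submodular (x \ chi T) (Function.update x i false)
    rw [h1, h2] at this
    linarith

/-- Few coordinates are influential on average: in every set, at most `1 + 1 / α` elements increase
the value of the remaining ones by more than the factor `1 + α`. -/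
theorem sum_P_big_le {n : ℕ} {f : Cube n → ℝ} (hf : IsMonotoneSubmodular f) {α : ℝ} (hα : 0 < α)
    (p : unitInterval) : p * ∑ i, (cube n p).P (Big f α i) ≤ 1 + 1 / α := by
  have hpt : ∀ x : Cube n, ∑ i, ind (x i = true ∧ Big f α i x) ≤ 1 + 1 / α := by
    intro x
    have hterm : ∀ i, ind (x i = true ∧ Big f α i x) * (α / (1 + α) * f x)
        ≤ f x - f (Function.update x i false) := by
      intro i
      by_cases h : x i = true ∧ Big f α i x
      · rw [ind_of_true h, one_mul]
        have h1 : Function.update x i true = x := by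
          rw [Function.update_eq_self_iff]; exact h.1.symm
        have h2 := h.2
        unfold Big at h2
        rw [h1] at h2
        rw [div_mul_eq_mul_div, div_le_iff₀ (by linarith)]
        nlinarith
      · rw [ind_of_false h, zero_mul]
        have : Function.update x i false ≤ x := update_le_iff.2 ⟨bot_le, fun _ _ => le_rfl⟩
        linarith [hf.monotone this]
    rcases (hf.nonneg x).lt_or_eq with hpos | hzero
    · have hsum : (∑ i, ind (x i = true ∧ Big f α i x)) * (α / (1 + α) * f x) ≤ f x := by
        rw [Finset.sum_mul]
        exact (Finset.sum_le_sum fun i _ => hterm i).trans (sum_marginal_le hf x)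
      have h3 : (∑ i, ind (x i = true ∧ Big f α i x)) * (α / (1 + α)) ≤ 1 := by
        rw [← mul_assoc] at hsum
        nlinarith
      rw [mul_div_assoc', div_le_one (by linarith)] at h3
      have : 1 + 1 / α = (1 + α) / α := by field_simp; ring
      rw [this, le_div_iff₀ hα]
      exact h3
    · rw [Finset.sum_eq_zero]
      · positivity
      · intro i _
        refine ind_of_false ?_
        rintro ⟨hx, hb⟩
        have h1 : Function.update x i true = x := by
          rw [Function.update_eq_self_iff]; exact hx.symm
        unfold Big at hb
        rw [h1, ← hzero] at hb
        have := hf.nonneg (Function.update x i false)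
        nlinarith
  have hE : ∀ i, (cube n p).E (fun x => ind (x i = true ∧ Big f α i x))
      = p * (cube n p).P (Big f α i) := by
    intro i
    have hb : ∀ x b, Big f α i (Function.update x i b) ↔ Big f α i x := by
      intro x b; simp [Big]
    rw [P, E_cube_update p i, E_cube_update p i (fun x => ind (Big f α i x))]
    simp only [Function.update_self, hb, true_and]
    rw [show (fun x : Cube n => ind (false = true ∧ Big f α i x)) = fun _ => 0 by
      funext x; exact ind_of_false (by simp), E_const]
    ring
  rw [Finset.mul_sum]
  simp only [← hE]
  rw [← E_sum]
  exact E_le_const _ hpt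

/-- The density `1 / (4 k)`, so small that the union of `k` random sets of this density has density
at most `1 / 4`. -/
noncomputable def sparseI (k : ℕ) : unitInterval :=
  ⟨1 / (4 * k), by positivity, by
    rcases Nat.eq_zero_or_pos k with rfl | hk
    · simp
    · have : (1 : ℝ) ≤ k := by exact_mod_cast hk
      rw [div_le_one (by positivity)]; linarith⟩

/-- The density `1 - √(1/2)`: the union of two independent sets of this density is uniform. -/
noncomputable def rootI : unitInterval :=
  ⟨1 - √(1 / 2), by
    rw [sub_nonneg]; exact Real.sqrt_le_iff.2 ⟨by norm_num, by norm_num⟩, by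
    have := Real.sqrt_nonneg (1 / 2); linarith⟩

theorem supI_rootI : supI rootI rootI = halfI := by
  apply Subtype.ext
  rw [coe_supI]
  have := Real.mul_self_sqrt (show (0 : ℝ) ≤ 1 / 2 by norm_num)
  simp only [rootI, halfI]
  ring_nf at this ⊢
  linarith

/-- The set of influential coordinates is small. -/
theorem card_influential_le {n : ℕ} {f : Cube n → ℝ} (hf : IsMonotoneSubmodular f) {α : ℝ}
    (hα : 0 < α) (hα1 : α ≤ 1) {k : ℕ} (hk : 0 < k) {J : Finset (Fin n)}
    (hJ : ∀ i ∈ J, 1 / 4 ≤ (cube n (sparseI k)).P (Big f α i)) :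
    (J.card : ℝ) ≤ 32 * k / α := by
  have hk' : (0 : ℝ) < k := by exact_mod_cast hk
  have h1 := sum_P_big_le hf hα (sparseI k)
  have h2 : (J.card : ℝ) * (1 / 4) ≤ ∑ i, (cube n (sparseI k)).P (Big f α i) := by
    calc (J.card : ℝ) * (1 / 4) = ∑ i ∈ J, (1 / 4 : ℝ) := by simp
      _ ≤ ∑ i ∈ J, (cube n (sparseI k)).P (Big f α i) := Finset.sum_le_sum hJ
      _ ≤ _ := Finset.sum_le_sum_of_subset_of_nonneg (Finset.subset_univ _)
          fun i _ _ => P_nonneg _ _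
  have h3 : ((sparseI k : unitInterval) : ℝ) = 1 / (4 * k) := rfl
  rw [h3, div_mul_eq_mul_div, one_mul, div_le_iff₀ (by positivity)] at h1
  have h4 : 1 + 1 / α ≤ 2 / α := by
    rw [le_div_iff₀ hα]; field_simp; linarith
  calc (J.card : ℝ) ≤ 4 * ((1 + 1 / α) * (4 * k)) := by linarith
    _ ≤ 4 * (2 / α * (4 * k)) := by gcongr
    _ = 32 * k / α := by ring

/-- With high probability no coordinate outside the set of influential ones is big. The sum over
all coordinates is controlled by `sum_P_big_le`, so the dimension does not enter. -/
theorem P_exists_big_le {n : ℕ} {f : Cube n → ℝ} (hf : IsMonotoneSubmodular f) {α : ℝ}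
    (hα : 0 < α) (hα1 : α ≤ 1) {k : ℕ} (hk : 0 < k) {J : Finset (Fin n)}
    (hJ : ∀ i ∉ J, (cube n (sparseI k)).P (Big f α i) ≤ 3 / 4) :
    (cube n rootI).P (fun x => ∃ i ∉ J, Big f α i x) ≤ (3 / 4) ^ (k - 1) * (8 * k / α) := by
  have hk' : (0 : ℝ) < k := by exact_mod_cast hk
  have hk1 : (1 : ℝ) ≤ k := by exact_mod_cast hk
  have h3 : ((sparseI k : unitInterval) : ℝ) = 1 / (4 * k) := rfl
  have hdens : 1 - (rootI : ℝ) ≤ (1 - (sparseI k : ℝ)) ^ k := by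
    have hb := one_add_mul_le_pow (a := -(1 / (4 * (k : ℝ)))) (by
      have : 1 / (4 * (k : ℝ)) ≤ 1 := by rw [div_le_one (by positivity)]; linarith
      linarith) k
    have h5 : (k : ℝ) * -(1 / (4 * k)) = -(1 / 4) := by field_simp
    have h6 : √(1 / 2 : ℝ) ≤ 3 / 4 := by
      rw [Real.sqrt_le_left (by norm_num)]; norm_num
    rw [h3]
    rw [h5, ← sub_eq_add_neg, ← sub_eq_add_neg] at hb
    simp only [rootI]
    linarith
  have h1 := sum_P_big_le hf hα (sparseI k)
  rw [h3, div_mul_eq_mul_div, one_mul, div_le_iff₀ (by positivity)] at h1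
  have h4 : 1 + 1 / α ≤ 2 / α := by
    rw [le_div_iff₀ hα]; field_simp; linarith
  have hone : ∀ i ∈ Jᶜ, (cube n rootI).P (Big f α i)
      ≤ (3 / 4) ^ (k - 1) * (cube n (sparseI k)).P (Big f α i) := by
    intro i hi
    refine (P_cube_le_pow hdens fun x y hxy hy => hy.anti hf hα.le hxy).trans ?_
    obtain ⟨j, rfl⟩ : ∃ j, k = j + 1 := ⟨k - 1, by omega⟩
    rw [pow_succ, Nat.add_sub_cancel]
    refine mul_le_mul_of_nonneg_right ?_ (P_nonneg _ _)
    exact pow_le_pow_left₀ (P_nonneg _ _) (hJ i (Finset.mem_compl.1 hi)) _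
  calc (cube n rootI).P (fun x => ∃ i ∉ J, Big f α i x)
      = (cube n rootI).P (fun x => ∃ i ∈ Jᶜ, Big f α i x) := by simp only [Finset.mem_compl]
    _ ≤ ∑ i ∈ Jᶜ, (cube n rootI).P (Big f α i) := P_exists_le _ _ _
    _ ≤ ∑ i ∈ Jᶜ, (3 / 4) ^ (k - 1) * (cube n (sparseI k)).P (Big f α i) :=
        Finset.sum_le_sum hone
    _ ≤ ∑ i, (3 / 4) ^ (k - 1) * (cube n (sparseI k)).P (Big f α i) :=
        Finset.sum_le_sum_of_subset_of_nonneg (Finset.subset_univ _)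
          fun i _ _ => mul_nonneg (by positivity) (P_nonneg _ _)
    _ = (3 / 4) ^ (k - 1) * ∑ i, (cube n (sparseI k)).P (Big f α i) := by rw [Finset.mul_sum]
    _ ≤ (3 / 4) ^ (k - 1) * (2 / α * (4 * k)) := by
        refine mul_le_mul_of_nonneg_left (h1.trans ?_) (by positivity)
        gcongr
    _ = (3 / 4) ^ (k - 1) * (8 * k / α) := by ring

/-! ### Rerandomizing the other coordinates -/

theorem splice_splice {n : ℕ} (J : Finset (Fin n)) (x y z : Cube n) :
    splice J (splice J x y) z = splice J x z := by
  funext i; by_cases h : i ∈ J <;> simp [splice, h]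

theorem splice_mono {n : ℕ} (J : Finset (Fin n)) {x x' y y' : Cube n} (hx : x ≤ x')
    (hy : y ≤ y') : splice J x y ≤ splice J x' y' := by
  intro i; by_cases h : i ∈ J
  · simpa only [splice, h, if_true] using hx i
  · simpa only [splice, h, if_false] using hy i

/-- A random set that contains no big coordinate outside `J` determines the values of `f` at
its random extensions outside `J` up to a factor. -/
theorem E_P_not_close_le {n : ℕ} {f : Cube n → ℝ} (hf : IsMonotoneSubmodular f) {α δ t : ℝ}
    (hα : 0 < α) (h0 : 0 ≤ δ) (h2 : δ ≤ 1) (ht : 1 ≤ t) (hδt : 1 + δ ≤ t * (1 - δ))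
    (J : Finset (Fin n)) (p : unitInterval) (a u : Cube n) :
    (cube n p).E (fun y => (cube n p).P fun y' =>
        ¬ Close t (f (splice J a (u ⊔ y))) (f (splice J a (u ⊔ y'))))
      ≤ ind (∃ i ∉ J, Big f α i (splice J a u)) + 4 * Real.exp (-(δ ^ 2 / (4 * α))) := by
  by_cases hbad : ∃ i ∉ J, Big f α i (splice J a u)
  · rw [ind_of_true hbad]
    have : (cube n p).E (fun y => (cube n p).P fun y' =>
        ¬ Close t (f (splice J a (u ⊔ y))) (f (splice J a (u ⊔ y')))) ≤ 1 :=
      E_le_const _ fun y => P_le_one _ _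
    have := Real.exp_pos (-(δ ^ 2 / (4 * α)))
    linarith
  · rw [ind_of_false hbad, zero_add]
    push Not at hbad
    have hg : IsMonotoneSubmodular fun y => f (splice J a (u ⊔ y)) := by
      refine ⟨fun y => hf.nonneg _, fun y y' h => ?_, fun y y' => ?_⟩
      · exact hf.monotone (splice_mono J le_rfl (sup_le_sup_left h u))
      · have := hf.submodular (splice J a (u ⊔ y)) (splice J a (u ⊔ y'))
        have e1 : splice J a (u ⊔ y) ⊔ splice J a (u ⊔ y') = splice J a (u ⊔ (y ⊔ y')) := by
          funext i; by_cases h : i ∈ J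
          · simp [splice, h]
          · simp only [splice, h, if_false, Pi.sup_apply]; exact (sup_sup_distrib_left _ _ _).symm
        have e2 : splice J a (u ⊔ y) ⊓ splice J a (u ⊔ y') = splice J a (u ⊔ y ⊓ y') := by
          funext i; by_cases h : i ∈ J
          · simp [splice, h]
          · simp only [splice, h, if_false, Pi.sup_apply, Pi.inf_apply]
            exact (sup_inf_left _ _ _).symm
        rw [e1, e2] at this
        exact this
    refine P_not_close_le hg hα (fun i => ?_) h0 h2 ht hδt p
    simp only [sup_bot_eq]
    by_cases hi : i ∈ J
    · have : splice J a (u ⊔ Function.update ⊥ i true) = splice J a u := by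
        funext j
        by_cases hj : j ∈ J
        · simp [splice, hj]
        · have : j ≠ i := fun h => hj (h ▸ hi)
          simp [splice, hj, this]
      rw [this]
      nlinarith [hf.nonneg (splice J a u)]
    · have h3 := hbad i hi
      unfold Big at h3
      have h4 : splice J a (u ⊔ Function.update ⊥ i true)
          = Function.update (splice J a u) i true := by
        funext j
        by_cases hj : j = i
        · subst hj; simp [splice, hi]
        · by_cases hJ : j ∈ J <;> simp [splice, hj, hJ]
      have h5 : Function.update (splice J a u) i false ≤ splice J a u :=
        update_le_iff.2 ⟨bot_le, fun _ _ => le_rfl⟩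
      rw [h4]
      have := hf.monotone h5
      nlinarith

/-- Rerandomizing the coordinates outside `J` changes the value of `f` by little. A uniform set is
the union of two independent sets of density `1 - √(1/2)`, and exchanging one of them at a time
leaves the other one as a set that contains no big coordinate outside `J`. -/
theorem P_not_close_splice_le {n : ℕ} {f : Cube n → ℝ} (hf : IsMonotoneSubmodular f) {α δ t β : ℝ}
    (hα : 0 < α) (h0 : 0 ≤ δ) (h2 : δ ≤ 1) (ht : 1 ≤ t) (hδt : 1 + δ ≤ t * (1 - δ))
    {J : Finset (Fin n)} (hβ : (cube n rootI).P (fun x => ∃ i ∉ J, Big f α i x) ≤ β) :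
    (cube n halfI).E (fun x => (cube n halfI).P fun z =>
        ¬ Close (t ^ 2) (f x) (f (splice J x z)))
      ≤ 2 * (β + 4 * Real.exp (-(δ ^ 2 / (4 * α)))) := by
  set τ := 4 * Real.exp (-(δ ^ 2 / (4 * α))) with hτ
  set Q := cube n rootI with hQ
  set U := cube n halfI with hU
  have hUQ : ∀ φ : Cube n → ℝ, U.E φ = Q.E fun x => Q.E fun y => φ (x ⊔ y) := by
    intro φ
    rw [hU, ← supI_rootI, ← E_cube_sup]
  set K : Cube n → Cube n → ℝ := fun a u => Q.E fun y => Q.P fun y' =>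
    ¬ Close t (f (splice J a (u ⊔ y))) (f (splice J a (u ⊔ y'))) with hK
  have hKle : ∀ a u, K a u ≤ ind (∃ i ∉ J, Big f α i (splice J a u)) + τ :=
    fun a u => E_P_not_close_le hf hα h0 h2 ht hδt J rootI a u
  have hbad : U.E (fun a => Q.E fun u => ind (∃ i ∉ J, Big f α i (splice J a u))) ≤ β := by
    rw [hUQ]
    refine le_trans ?_ hβ
    rw [P, ← E_cube_splice rootI J fun x => ind (∃ i ∉ J, Big f α i x)]
    refine E_mono _ fun a₀ => ?_
    refine E_le_const _ fun a₁ => ?_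
    refine E_mono Q fun u => ind_le_ind ?_
    rintro ⟨i, hi, hb⟩
    exact ⟨i, hi, hb.anti hf hα.le (splice_mono J le_sup_left le_rfl)⟩
  have hKE : U.E (fun a => Q.E fun u => K a u) ≤ β + τ := by
    calc U.E (fun a => Q.E fun u => K a u)
        ≤ U.E (fun a => Q.E (fun u => ind (∃ i ∉ J, Big f α i (splice J a u))) + τ) := by
          refine E_mono _ fun a => ?_
          calc Q.E (fun u => K a u)
              ≤ Q.E (fun u => ind (∃ i ∉ J, Big f α i (splice J a u)) + τ) := E_mono _ (hKle a)
            _ = _ := by rw [E_add, E_const]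
      _ ≤ β + τ := by rw [E_add, E_const]; linarith
  have hswap : ∀ a, U.E (fun y => U.P fun z =>
      ¬ Close (t ^ 2) (f (splice J a y)) (f (splice J a z))) ≤ 2 * Q.E fun u => K a u := by
    intro a
    set F : Cube n → ℝ := fun y => f (splice J a y) with hF
    have h1 : ∀ y, U.P (fun z => ¬ Close (t ^ 2) (F y) (F z))
        = Q.E fun v₀ => Q.E fun v₁ => ind (¬ Close (t ^ 2) (F y) (F (v₀ ⊔ v₁))) := by
      intro y
      rw [P, hUQ]
    calc U.E (fun y => U.P fun z => ¬ Close (t ^ 2) (F y) (F z))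
        = Q.E fun u₀ => Q.E fun u₁ => Q.E fun v₀ => Q.E fun v₁ =>
            ind (¬ Close (t ^ 2) (F (u₀ ⊔ u₁)) (F (v₀ ⊔ v₁))) := by
          simp only [h1]
          rw [hUQ]
      _ ≤ Q.E fun u₀ => Q.E fun u₁ => Q.E fun v₀ => Q.E fun v₁ =>
            (ind (¬ Close t (F (u₀ ⊔ u₁)) (F (u₀ ⊔ v₁)))
              + ind (¬ Close t (F (u₀ ⊔ v₁)) (F (v₀ ⊔ v₁)))) := by
          refine E_mono _ fun u₀ => E_mono _ fun u₁ => E_mono _ fun v₀ => E_mono _ fun v₁ => ?_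
          by_cases c1 : Close t (F (u₀ ⊔ u₁)) (F (u₀ ⊔ v₁))
          · by_cases c2 : Close t (F (u₀ ⊔ v₁)) (F (v₀ ⊔ v₁))
            · rw [ind_of_false (not_not.2 (c1.trans (by linarith) c2))]
              exact add_nonneg (ind_nonneg _) (ind_nonneg _)
            · rw [ind_of_true c2]
              linarith [ind_le_one (¬ Close (t ^ 2) (F (u₀ ⊔ u₁)) (F (v₀ ⊔ v₁))),
                ind_nonneg (¬ Close t (F (u₀ ⊔ u₁)) (F (u₀ ⊔ v₁)))]
          · rw [ind_of_true c1]
            linarith [ind_le_one (¬ Close (t ^ 2) (F (u₀ ⊔ u₁)) (F (v₀ ⊔ v₁))),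
              ind_nonneg (¬ Close t (F (u₀ ⊔ v₁)) (F (v₀ ⊔ v₁)))]
      _ = Q.E (fun u => K a u) + Q.E fun u₀ => Q.E fun v₀ => Q.E fun v₁ =>
            ind (¬ Close t (F (u₀ ⊔ v₁)) (F (v₀ ⊔ v₁))) := by
          simp only [E_add, E_const]
          rfl
      _ = Q.E (fun u => K a u) + Q.E (fun u => K a u) := by
          congr 1
          calc Q.E (fun u₀ => Q.E fun v₀ => Q.E fun v₁ =>
                ind (¬ Close t (F (u₀ ⊔ v₁)) (F (v₀ ⊔ v₁))))
              = Q.E (fun u₀ => Q.E fun v₁ => Q.E fun v₀ =>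
                ind (¬ Close t (F (u₀ ⊔ v₁)) (F (v₀ ⊔ v₁)))) := by
                congr 1
                funext u₀
                exact E_comm _ _ _
            _ = Q.E (fun v₁ => Q.E fun u₀ => Q.E fun v₀ =>
                ind (¬ Close t (F (u₀ ⊔ v₁)) (F (v₀ ⊔ v₁)))) := E_comm _ _ _
            _ = Q.E (fun u => K a u) := by
                congr 1
                funext v₁
                simp only [hK, P, hF, sup_comm _ v₁]
      _ = _ := by ring
  rw [hU, ← E_cube_splice halfI J]
  simp only [splice_splice, ← hU]
  calc U.E (fun a => U.E fun y => U.P fun z =>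
        ¬ Close (t ^ 2) (f (splice J a y)) (f (splice J a z)))
      ≤ U.E (fun a => 2 * Q.E fun u => K a u) := E_mono _ hswap
    _ = 2 * U.E (fun a => Q.E fun u => K a u) := E_mul_left _ _ _
    _ ≤ 2 * (β + τ) := by linarith

/-! ### Choice of the parameters -/

/-- `J` contains the coordinates that are big with probability more than `3 / 4` at a random set of
density `1 / (4 k)`, and only coordinates that are big with probability at least `1 / 4`. -/
structure IsInfluentialSet {n : ℕ} (f : Cube n → ℝ) (α : ℝ) (k : ℕ) (J : Finset (Fin n)) :
    Prop where
  mem_of_lt : ∀ i, 3 / 4 < (cube n (sparseI k)).P (Big f α i) → i ∈ J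
  le_of_mem : ∀ i ∈ J, 1 / 4 ≤ (cube n (sparseI k)).P (Big f α i)

/-- A geometric series bound: the factor `k` is absorbed by enlarging the ratio. -/
theorem nat_mul_pow_le {k : ℕ} (hk : 0 < k) :
    (3 / 4 : ℝ) ^ (k - 1) * k ≤ 6 * (7 / 8) ^ (k - 1) := by
  obtain ⟨j, rfl⟩ : ∃ j, k = j + 1 := ⟨k - 1, by omega⟩
  rw [Nat.add_sub_cancel]
  have h := one_add_mul_le_pow (a := (1 / 6 : ℝ)) (by norm_num) j
  have h1 : ((7 : ℝ) / 8) ^ j = (3 / 4) ^ j * (1 + 1 / 6) ^ j := by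
    rw [← mul_pow]; norm_num
  rw [h1]
  have h2 : (0 : ℝ) < (3 / 4) ^ j := by positivity
  push_cast
  nlinarith

/-- For every accuracy `γ` and failure probability `η` there are a threshold `α` and a boosting
parameter `k` such that the set of influential coordinates has the right size, and rerandomizing the
other coordinates changes the value by a factor of at most `(1 + γ / 8) ^ 2`, except with
probability `η`. -/
theorem exists_influential_params {γ η : ℝ} (hγ : 0 < γ) (hγ1 : γ < 1) (hη : 0 < η) (hη1 : η < 1) :
    ∃ (α : ℝ) (k : ℕ), ∀ (n : ℕ) (f : Cube n → ℝ), IsMonotoneSubmodular f →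
      ∀ J, IsInfluentialSet f α k J →
        (J.card : ℝ) ≤ 2560000 / γ ^ 2 * Real.log (16 / η) * Real.log (16 / (γ * η)) ∧
        (cube n halfI).E (fun x => (cube n halfI).P fun z =>
          ¬ Close ((1 + γ / 8) ^ 2) (f x) (f (splice J x z))) ≤ η := by
  have hγη : 0 < γ * η := mul_pos hγ hη
  have hγη1 : γ * η ≤ 1 := by nlinarith
  have hlog16 : (1 : ℝ) ≤ Real.log 16 := by
    rw [Real.le_log_iff_exp_le (by norm_num)]
    linarith [Real.exp_one_lt_d9]
  have hℓ1 : 1 ≤ Real.log (16 / η) := by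
    refine hlog16.trans (Real.log_le_log (by norm_num) ?_)
    rw [le_div_iff₀ hη]; linarith
  have hm1 : 1 ≤ Real.log (16 / (γ * η)) := by
    refine hlog16.trans (Real.log_le_log (by norm_num) ?_)
    rw [le_div_iff₀ hγη]; linarith
  have hℓη : Real.log (16 / η) ≤ 16 / η := by
    have := Real.log_le_sub_one_of_pos (show 0 < 16 / η by positivity)
    linarith
  set ℓ := Real.log (16 / η) with hℓ
  set m := Real.log (16 / (γ * η)) with hm
  set b := Real.log (2300 / (γ * η)) with hb
  have hb0 : 0 ≤ b := by
    refine Real.log_nonneg ?_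
    rw [le_div_iff₀ hγη]; linarith
  have hbm : b ≤ 3 * m := by
    have h3 : (3 : ℝ) * m = Real.log ((16 / (γ * η)) ^ 3) := by
      rw [Real.log_pow, hm]; norm_num
    rw [h3]
    refine Real.log_le_log (by positivity) ?_
    rw [div_pow, div_le_div_iff₀ hγη (by positivity)]
    have : (γ * η) ^ 2 ≤ 1 := by nlinarith
    nlinarith
  set α := γ ^ 2 / (1600 * ℓ) with hα
  have hα0 : 0 < α := by positivity
  have hα1 : α ≤ 1 := by
    rw [hα, div_le_one (by positivity)]
    nlinarith
  set k := ⌈16 * b⌉₊ + 1 with hk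
  have hk0 : 0 < k := Nat.succ_pos _
  have hkge : 16 * b ≤ ((k - 1 : ℕ) : ℝ) := by
    rw [hk, Nat.add_sub_cancel]
    exact Nat.le_ceil _
  have hkle : (k : ℝ) ≤ 50 * m := by
    have := Nat.ceil_lt_add_one (show 0 ≤ 16 * b by linarith)
    rw [hk]
    push_cast
    linarith
  refine ⟨α, k, fun n f hf J hJ => ⟨?_, ?_⟩⟩
  · refine (card_influential_le hf hα0 hα1 hk0 hJ.le_of_mem).trans ?_
    calc 32 * (k : ℝ) / α ≤ 32 * (50 * m) / α := by gcongr
      _ = 2560000 / γ ^ 2 * ℓ * m := by rw [hα]; field_simp; ring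
  · have hβ := P_exists_big_le hf hα0 hα1 hk0 (J := J) fun i hi => by
      by_contra! h
      exact hi (hJ.mem_of_lt i h)
    have hpow : (7 / 8 : ℝ) ^ (k - 1) ≤ (γ * η) ^ 2 / 5290000 := by
      have h78 : (7 / 8 : ℝ) ≤ Real.exp (-(1 / 8)) := by
        have := Real.add_one_le_exp (-(1 / 8 : ℝ))
        linarith
      calc (7 / 8 : ℝ) ^ (k - 1) ≤ Real.exp (-(1 / 8)) ^ (k - 1) := by gcongr
        _ = Real.exp (((k - 1 : ℕ) : ℝ) * (-(1 / 8))) := by rw [← Real.exp_nat_mul]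
        _ ≤ Real.exp (-b + -b) := Real.exp_le_exp.2 (by linarith)
        _ = (γ * η) ^ 2 / 5290000 := by
          rw [Real.exp_add, Real.exp_neg, hb, Real.exp_log (by positivity)]
          field_simp
          ring
    have hβ' : (cube n rootI).P (fun x => ∃ i ∉ J, Big f α i x) ≤ η / 4 := by
      refine hβ.trans ?_
      have h5 : (7 / 8 : ℝ) ^ (k - 1) / α ≤ η / 192 := by
        rw [div_le_div_iff₀ hα0 (by norm_num)]
        have h7 : (γ * η) ^ 2 / 5290000 * 192 ≤ η * α := by
          have h8 : ℓ * η ≤ 16 := by rwa [le_div_iff₀ hη] at hℓη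
          rw [hα, mul_div_assoc', div_mul_eq_mul_div, div_le_div_iff₀ (by norm_num) (by positivity)]
          nlinarith [mul_le_mul_of_nonneg_left h8 (show 0 ≤ γ ^ 2 * η by positivity)]
        linarith
      calc (3 / 4 : ℝ) ^ (k - 1) * (8 * k / α) = (3 / 4 : ℝ) ^ (k - 1) * k * (8 / α) := by ring
        _ ≤ 6 * (7 / 8) ^ (k - 1) * (8 / α) :=
            mul_le_mul_of_nonneg_right (nat_mul_pow_le hk0) (by positivity)
        _ = 48 * ((7 / 8) ^ (k - 1) / α) := by ring
        _ ≤ 48 * (η / 192) := by gcongr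
        _ = η / 4 := by ring
    -- with deviation `γ / 20` the exponent of the tail bound is exactly `log (16 / η)`
    have hfin := P_not_close_splice_le hf hα0 (δ := γ / 20) (t := 1 + γ / 8) (by linarith)
      (by linarith) (by linarith) (by nlinarith) hβ'
    refine hfin.trans (le_of_eq ?_)
    have hexp : (γ / 20) ^ 2 / (4 * α) = ℓ := by rw [hα]; field_simp; norm_num
    rw [hexp, Real.exp_neg, hℓ, Real.exp_log (by positivity)]
    field_simp
    ring

/-! ### Query algorithms -/

namespace QueryAlg

variable {n : ℕ} {α β : Type}

/-- Run an algorithm and continue with another one that depends on its result. -/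
def bind (g : α → QueryAlg n β) : QueryAlg n α → QueryAlg n β
  | done a => g a
  | query x next => query x fun v => (next v).bind g

theorem run_bind (f : Cube n → ℝ) (g : α → QueryAlg n β) (A : QueryAlg n α) :
    (A.bind g).run f = (g (A.run f)).run f := by
  induction A with
  | done a => rfl
  | query x next ih => exact ih _

theorem numQueries_bind (f : Cube n → ℝ) (g : α → QueryAlg n β) (A : QueryAlg n α) :
    (A.bind g).numQueries f = A.numQueries f + (g (A.run f)).numQueries f := by
  induction A with
  | done a => simp [bind, numQueries, run]
  | query x next ih => simp only [bind, numQueries, run, ih]; omega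

theorem QueriesAtMost.bind {A : QueryAlg n α} {g : α → QueryAlg n β} {q q' : ℕ}
    (hA : A.QueriesAtMost q) (hg : ∀ a, (g a).QueriesAtMost q') :
    (A.bind g).QueriesAtMost (q + q') := fun f => by
  rw [numQueries_bind]
  exact add_le_add (hA f) (hg _ f)

theorem QueriesAtMost.mono {A : QueryAlg n α} {q q' : ℕ} (hA : A.QueriesAtMost q) (h : q ≤ q') :
    A.QueriesAtMost q' := fun f => (hA f).trans h

theorem queriesAtMost_done (a : α) (q : ℕ) : (done a : QueryAlg n α).QueriesAtMost q :=
  fun _ => Nat.zero_le _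

/-- Run finitely many algorithms one after the other and collect the results. -/
theorem exists_collect {ι : Type} [Fintype ι] (A : ι → QueryAlg n α) {q : ℕ}
    (hA : ∀ i, (A i).QueriesAtMost q) :
    ∃ B : QueryAlg n (ι → α), B.QueriesAtMost (Fintype.card ι * q) ∧
      ∀ f, B.run f = fun i => (A i).run f := by
  suffices H : ∀ (m : ℕ) (A : Fin m → QueryAlg n α), (∀ i, (A i).QueriesAtMost q) →
      ∃ B : QueryAlg n (Fin m → α), B.QueriesAtMost (m * q) ∧
        ∀ f, B.run f = fun i => (A i).run f by
    let e := Fintype.equivFin ι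
    obtain ⟨B, hB, hr⟩ := H _ (fun i => A (e.symm i)) fun i => hA _
    refine ⟨B.bind fun v => done fun i => v (e i), ?_, fun f => ?_⟩
    · exact hB.bind (q' := 0) fun a => queriesAtMost_done _ _
    · rw [run_bind, hr]
      simp [run]
  intro m
  induction m with
  | zero =>
    intro A _
    exact ⟨done fun i => i.elim0, queriesAtMost_done _ _, fun f => funext fun i => i.elim0⟩
  | succ m ih =>
    intro A hA
    obtain ⟨B, hB, hr⟩ := ih (fun i => A i.succ) fun i => hA _
    refine ⟨(A 0).bind fun a => B.bind fun v => done (Fin.cons a v), ?_, fun f => ?_⟩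
    · refine ((hA 0).bind fun a => hB.bind (q' := 0) fun v => queriesAtMost_done _ _).mono ?_
      rw [add_mul]; omega
    · rw [run_bind, run_bind, hr]
      funext i
      refine Fin.cases ?_ (fun i => ?_) i <;> simp [run]

/-- Query the values at finitely many points. -/
theorem exists_ask {ι : Type} [Fintype ι] (pts : ι → Cube n) (g : (ι → ℝ) → α) :
    ∃ B : QueryAlg n α, B.QueriesAtMost (Fintype.card ι) ∧
      ∀ f, B.run f = g fun i => f (pts i) := by
  obtain ⟨B, hB, hr⟩ := exists_collect (fun i => query (pts i) fun v => (done v : QueryAlg n ℝ))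
    (q := 1) fun i f => le_rfl
  refine ⟨B.bind fun v => done (g v), ?_, fun f => ?_⟩
  · have := hB.bind (q' := 0) fun v => queriesAtMost_done (n := n) (g v) 0
    simpa using this
  · rw [run_bind, hr]
    rfl

end QueryAlg

/-- A random choice among deterministic algorithms. -/
theorem exists_randQueryAlg {n : ℕ} {α Ω : Type} [Fintype Ω] (μ : FinProb Ω)
    (D : Ω → QueryAlg n α) {q : ℕ} (hD : ∀ ω, (D ω).QueriesAtMost q) :
    ∃ A : RandQueryAlg n α, A.QueriesAtMost q ∧ ∀ f (G : Set α),
      A.successProb f G = ENNReal.ofReal (μ.P fun ω => (D ω).run f ∈ G) := by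
  refine ⟨μ.toPMF.map D, ?_, fun f G => ?_⟩
  · intro A hA
    obtain ⟨ω, _, rfl⟩ := (PMF.mem_support_map_iff _ _ _).1 hA
    exact hD ω
  · rw [RandQueryAlg.successProb, PMF.toOuterMeasure_map_apply, ← toOuterMeasure_toPMF]
    rfl

/-! ### Estimating the influential coordinates -/

/-- The coordinates that are big at no fewer than half of the samples. -/
noncomputable def sampledSet {n m : ℕ} (f : Cube n → ℝ) (α : ℝ) (R : Fin m → Cube n) :
    Finset (Fin n) := by
  classical exact Finset.univ.filter fun i => 1 / 2 ≤ (∑ r, ind (Big f α i (R r))) / (m : ℝ)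

theorem exists_sampledSet_alg {n m : ℕ} (α : ℝ) (R : Fin m → Cube n) :
    ∃ B : QueryAlg n (Finset (Fin n)), B.QueriesAtMost (2 * (m * n)) ∧
      ∀ f, B.run f = sampledSet f α R := by
  classical
  obtain ⟨B, hB, hr⟩ := QueryAlg.exists_ask
    (fun c : Bool × Fin m × Fin n => Function.update (R c.2.1) c.2.2 c.1)
    (fun v => Finset.univ.filter fun i => 1 / 2 ≤
      (∑ r, ind ((1 + α) * v (false, r, i) < v (true, r, i))) / (m : ℝ))
  refine ⟨B, by simpa using hB, fun f => ?_⟩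
  rw [hr]
  ext i
  simp [sampledSet, Big]

/-- Few samples suffice, as the required accuracy is constant. -/
theorem P_not_isInfluentialSet_le {n m : ℕ} (hm : 0 < m) (f : Cube n → ℝ) (α : ℝ) (k : ℕ) :
    (iid (cube n (sparseI k)) m).P (fun R => ¬ IsInfluentialSet f α k (sampledSet f α R))
      ≤ 16 * n / m := by
  classical
  set μ := cube n (sparseI k) with hμ
  have hm' : (0 : ℝ) < m := by exact_mod_cast hm
  calc (iid μ m).P (fun R => ¬ IsInfluentialSet f α k (sampledSet f α R))
      ≤ (iid μ m).P (fun R => ∃ i ∈ (Finset.univ : Finset (Fin n)),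
          1 / 4 ≤ |(∑ r, ind (Big f α i (R r))) / (m : ℝ) - μ.P (Big f α i)|) := by
        refine P_mono _ fun R hR => ?_
        by_contra! hcon
        refine hR ⟨fun i hi => ?_, fun i hi => ?_⟩
        · have := abs_lt.1 (hcon i (Finset.mem_univ i))
          simp only [sampledSet, Finset.mem_filter, Finset.mem_univ, true_and]
          linarith
        · have := abs_lt.1 (hcon i (Finset.mem_univ i))
          simp only [sampledSet, Finset.mem_filter, Finset.mem_univ, true_and] at hi
          linarith
    _ ≤ ∑ i : Fin n, (iid μ m).P (fun R =>
          1 / 4 ≤ |(∑ r, ind (Big f α i (R r))) / (m : ℝ) - μ.P (Big f α i)|) := P_exists_le _ _ _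
    _ ≤ ∑ _i : Fin n, 1 / ((m : ℝ) * (1 / 4) ^ 2) :=
        Finset.sum_le_sum fun i _ => P_empirical_le μ _ hm (by norm_num)
    _ = 16 * n / m := by
        rw [Finset.sum_const, Finset.card_univ, Fintype.card_fin, nsmul_eq_mul]
        field_simp
        norm_num

/-! ### Hypotheses and their selection by testing -/

/-- The success probability of a candidate `h`. -/
noncomputable def score {n : ℕ} (γ : ℝ) (f h : Cube n → ℝ) : ℝ :=
  (cube n halfI).P fun x => f x ≤ h x ∧ h x ≤ (1 + γ) * f x

theorem isJuntaApprox_splice {n : ℕ} {f : Cube n → ℝ} (hf : IsMonotoneSubmodular f)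
    {γ ε k s : ℝ} {J : Finset (Fin n)} (hJ : (J.card : ℝ) ≤ k) (hs : 0 ≤ s) (z : Cube n)
    (h : 1 - ε ≤ score γ f fun x => s * f (splice J x z)) :
    IsJuntaApprox f γ ε k J fun x => s * f (splice J x z) where
  card_le := hJ
  monotoneSubmodular := by
    refine ⟨fun x => mul_nonneg hs (hf.nonneg _), fun x y hxy => ?_, fun x y => ?_⟩
    · exact mul_le_mul_of_nonneg_left (hf.monotone (splice_mono J hxy le_rfl)) hs
    · have h1 : splice J (x ⊔ y) z = splice J x z ⊔ splice J y z := by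
        funext i; by_cases hi : i ∈ J <;> simp [splice, hi]
      have h2 : splice J (x ⊓ y) z = splice J x z ⊓ splice J y z := by
        funext i; by_cases hi : i ∈ J <;> simp [splice, hi]
      have := mul_le_mul_of_nonneg_left (hf.submodular (splice J x z) (splice J y z)) hs
      simp only [h1, h2]
      linarith
  dependsOn := by
    intro x y hxy
    have : splice J x z = splice J y z := by
      funext i
      by_cases hi : i ∈ J
      · simpa [splice, hi] using hxy i hi
      · simp [splice, hi]
    simp only [this]
  approx := by
    rw [IsMultApprox, uniformProb_eq]
    exact h

/-- The procedure that computes `s * f (splice J x z)` by one query. -/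
def spliceOracle {n : ℕ} (J : Finset (Fin n)) (z : Cube n) (s : ℝ) : OracleJunta n :=
  (J, fun x => QueryAlg.query (splice J x z) fun v => QueryAlg.done (s * v))

/-- A learned procedure is correct: it is cheap and computes an approximating junta. -/
def IsCorrect {n : ℕ} (f : Cube n → ℝ) (γ ε k : ℝ) (q : ℕ) (r : OracleJunta n) : Prop :=
  (∀ x, (r.2 x).QueriesAtMost q) ∧ IsJuntaApprox f γ ε k r.1 fun x => (r.2 x).run f

theorem isCorrect_spliceOracle {n : ℕ} {f : Cube n → ℝ} (hf : IsMonotoneSubmodular f)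
    {γ ε k s : ℝ} {J : Finset (Fin n)} (hJ : (J.card : ℝ) ≤ k) (hs : 0 ≤ s) (z : Cube n)
    (h : 1 - ε ≤ score γ f fun x => s * f (splice J x z)) {q : ℕ} (hq : 1 ≤ q) :
    IsCorrect f γ ε k q (spliceOracle J z s) :=
  ⟨fun _ _ => hq, isJuntaApprox_splice hf hJ hs z h⟩

/-- Among finitely many candidates that differ in the values outside `J` and in the scale, the
one that succeeds on most of `m` random test points is nearly the best one. -/
theorem exists_select_alg {n m : ℕ} (hm : 0 < m) {κ : Type} [Fintype κ] [Nonempty κ]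
    (J : Finset (Fin n)) (z : κ → Cube n) (s : κ → ℝ) (hs : ∀ c, 0 ≤ s c) (γ ε k acc : ℝ)
    (hacc : 0 < acc) :
    ∃ D : (Fin m → Cube n) → QueryAlg n (OracleJunta n),
      (∀ X, (D X).QueriesAtMost (m + m * Fintype.card κ)) ∧
      ∀ f, IsMonotoneSubmodular f → (J.card : ℝ) ≤ k →
        (∃ c, 1 - ε + 2 * acc ≤ score γ f fun x => s c * f (splice J x (z c))) →
        ∀ q, 1 ≤ q → (iid (cube n halfI) m).P (fun X => ¬ IsCorrect f γ ε k q ((D X).run f))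
          ≤ Fintype.card κ / (m * acc ^ 2) := by
  classical
  -- the event that candidate `c` is right, in terms of the values at a test point and its splice
  set ok : κ → ℝ → ℝ → Prop := fun c v w => v ≤ s c * w ∧ s c * w ≤ (1 + γ) * v with hok
  have hmax : ∀ e : κ → ℝ, ∃ c, ∀ c', e c' ≤ e c := fun e => Finite.exists_max e
  choose best hbest using hmax
  have hD : ∀ X : Fin m → Cube n, ∃ B : QueryAlg n (OracleJunta n),
      B.QueriesAtMost (m + m * Fintype.card κ) ∧ ∀ f, B.run f =
        let c := best fun c => (∑ r, ind (ok c (f (X r)) (f (splice J (X r) (z c))))) / (m : ℝ)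
        spliceOracle J (z c) (s c) := by
    intro X
    obtain ⟨B, hB, hr⟩ := QueryAlg.exists_ask
      (fun i : Fin m ⊕ Fin m × κ => Sum.elim X (fun i => splice J (X i.1) (z i.2)) i)
      (fun v => let c := best fun c =>
          (∑ r, ind (ok c (v (Sum.inl r)) (v (Sum.inr (r, c))))) / (m : ℝ)
        spliceOracle J (z c) (s c))
    exact ⟨B, by simpa using hB, fun f => hr f⟩
  choose D hDq hDr using hD
  refine ⟨D, hDq, fun f hf hJ ⟨c₀, hc₀⟩ q hq => ?_⟩
  set μ := cube n halfI with hμ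
  set S : κ → Cube n → Prop := fun c x => ok c (f x) (f (splice J x (z c))) with hS
  have hscore : ∀ c, score γ f (fun x => s c * f (splice J x (z c))) = μ.P (S c) := fun c => rfl
  calc (iid μ m).P (fun X => ¬ IsCorrect f γ ε k q ((D X).run f))
      ≤ (iid μ m).P (fun X => ∃ c ∈ (Finset.univ : Finset κ),
          acc ≤ |(∑ r, ind (S c (X r))) / (m : ℝ) - μ.P (S c)|) := by
        refine P_mono _ fun X hX => ?_
        by_contra! hcon
        refine hX ?_
        rw [hDr]
        set e : κ → ℝ := fun c => (∑ r, ind (S c (X r))) / (m : ℝ) with he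
        refine isCorrect_spliceOracle hf hJ (hs _) _ ?_ hq
        rw [hscore]
        have h1 := abs_lt.1 (hcon c₀ (Finset.mem_univ _))
        have h2 := abs_lt.1 (hcon (best e) (Finset.mem_univ _))
        have h3 : (∑ r, ind (S c₀ (X r))) / (m : ℝ) ≤ (∑ r, ind (S (best e) (X r))) / (m : ℝ) :=
          hbest e c₀
        rw [hscore] at hc₀
        linarith
    _ ≤ ∑ c : κ, (iid μ m).P (fun X =>
          acc ≤ |(∑ r, ind (S c (X r))) / (m : ℝ) - μ.P (S c)|) := P_exists_le _ _ _
    _ ≤ ∑ _c : κ, 1 / ((m : ℝ) * acc ^ 2) :=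
        Finset.sum_le_sum fun c _ => P_empirical_le μ _ hm hacc
    _ = Fintype.card κ / (m * acc ^ 2) := by
        rw [Finset.sum_const, Finset.card_univ, nsmul_eq_mul, mul_one_div]

/-- An approximation up to the factor `(1 + γ) ^ L` can be scaled down to one up to the factor
`1 + γ`. -/
theorem exists_scale {γ A B : ℝ} (hγ : 0 < γ) {L : ℕ} (hL : 0 < L) (hAB : A ≤ B)
    (hB : B ≤ (1 + γ) ^ L * A) :
    ∃ j < L, A ≤ B / (1 + γ) ^ j ∧ B / (1 + γ) ^ j ≤ (1 + γ) * A := by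
  have hpos : ∀ j : ℕ, 0 < (1 + γ) ^ j := fun j => by positivity
  have hex : ∃ j : ℕ, B / (1 + γ) ^ j ≤ (1 + γ) * A := by
    refine ⟨L - 1, ?_⟩
    rw [div_le_iff₀ (hpos _), mul_right_comm, ← pow_succ', Nat.sub_add_cancel hL]
    exact hB
  classical
  have hspec := Nat.find_spec hex
  have hmin : Nat.find hex ≤ L - 1 := Nat.find_min' hex (by
    rw [div_le_iff₀ (hpos _), mul_right_comm, ← pow_succ', Nat.sub_add_cancel hL]
    exact hB)
  refine ⟨Nat.find hex, by omega, ?_, hspec⟩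
  rcases Nat.eq_zero_or_pos (Nat.find hex) with h0 | h0
  · rw [h0, pow_zero, div_one]; exact hAB
  · have h1 := Nat.find_min hex (Nat.sub_lt h0 one_pos)
    push Not at h1
    rw [lt_div_iff₀ (hpos _), mul_right_comm, ← pow_succ', Nat.sub_add_cancel (show 1 ≤ Nat.find hex from h0)] at h1
    rw [le_div_iff₀ (hpos _), mul_comm]
    exact h1.le

/-- One of the scales of a coarse approximation succeeds with at least the average probability. -/
theorem exists_score_ge {n : ℕ} {f g : Cube n → ℝ} {γ σ : ℝ} (hγ : 0 < γ) {L : ℕ} (hL : 0 < L)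
    (h : σ ≤ (cube n halfI).P fun x => f x ≤ g x ∧ g x ≤ (1 + γ) ^ L * f x) :
    ∃ j : Fin L, σ / L ≤ score γ f fun x => g x / (1 + γ) ^ (j : ℕ) := by
  by_contra! hcon
  have hL' : (0 : ℝ) < L := by exact_mod_cast hL
  have hne : (Finset.univ : Finset (Fin L)).Nonempty := ⟨⟨0, hL⟩, Finset.mem_univ _⟩
  have h1 : (cube n halfI).P (fun x => f x ≤ g x ∧ g x ≤ (1 + γ) ^ L * f x)
      ≤ (cube n halfI).P (fun x => ∃ j ∈ (Finset.univ : Finset (Fin L)),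
          f x ≤ g x / (1 + γ) ^ (j : ℕ) ∧ g x / (1 + γ) ^ (j : ℕ) ≤ (1 + γ) * f x) := by
    refine P_mono _ fun x hx => ?_
    obtain ⟨j, hj, h2⟩ := exists_scale hγ hL hx.1 hx.2
    exact ⟨⟨j, hj⟩, Finset.mem_univ _, h2⟩
  have h2 := P_exists_le (cube n halfI) (Finset.univ : Finset (Fin L)) fun j x =>
    f x ≤ g x / (1 + γ) ^ (j : ℕ) ∧ g x / (1 + γ) ^ (j : ℕ) ≤ (1 + γ) * f x
  have h3 := Finset.sum_lt_sum_of_nonempty hne fun j _ => hcon j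
  rw [Finset.sum_const, Finset.card_univ, Fintype.card_fin, nsmul_eq_mul,
    mul_div_cancel₀ _ hL'.ne'] at h3
  exact absurd (h.trans (h1.trans h2)) (not_le.2 h3)

/-- The complement of a uniformly random point is uniformly random. -/
theorem P_cube_compl {n : ℕ} (S : Cube n → Prop) :
    (cube n halfI).P (fun x => S xᶜ) = (cube n halfI).P S := by
  refine E_pi_map (fun _ => bern halfI) (fun _ => bern halfI) (fun _ b => !b) (fun i ψ => ?_)
    fun x => ind (S x)
  simp only [E_bern, halfI]
  norm_num
  ring

theorem top_le_add_compl {n : ℕ} {f : Cube n → ℝ} (hf : IsMonotoneSubmodular f) (x : Cube n) :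
    f ⊤ ≤ f x + f xᶜ := by
  have := hf.submodular x xᶜ
  rw [sup_compl_eq_top, inf_compl_eq_bot] at this
  linarith [hf.nonneg ⊥]

/-- At least half of the points have at least half of the maximal value. -/
theorem half_le_P_top {n : ℕ} {f : Cube n → ℝ} (hf : IsMonotoneSubmodular f) :
    1 / 2 ≤ (cube n halfI).P fun x => f x ≤ f ⊤ ∧ f ⊤ ≤ 2 * f x := by
  have h1 := P_or_le (cube n halfI) (fun x => f ⊤ ≤ 2 * f x) fun x => f ⊤ ≤ 2 * f xᶜ
  rw [P_cube_compl fun x => f ⊤ ≤ 2 * f x] at h1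
  have h2 : (1 : ℝ) ≤ (cube n halfI).P fun x => f ⊤ ≤ 2 * f x ∨ f ⊤ ≤ 2 * f xᶜ := by
    refine const_le_E _ fun x => (ind_of_true ?_).ge
    by_contra! h
    have := top_le_add_compl hf x
    linarith
  have h3 : (cube n halfI).P (fun x => f ⊤ ≤ 2 * f x)
      ≤ (cube n halfI).P fun x => f x ≤ f ⊤ ∧ f ⊤ ≤ 2 * f x :=
    P_mono _ fun x hx => ⟨hf.monotone le_top, hx⟩
  linarith

/-! ### Learning procedures -/

/-- Some randomized algorithm makes at most `q` queries and outputs, except with probability `τ`, a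
procedure of at most `q` queries per value that computes an approximating junta of size `k`. -/
def Learnable (n : ℕ) (γ ε k τ : ℝ) (q : ℕ) : Prop :=
  ∃ A : RandQueryAlg n (OracleJunta n), A.QueriesAtMost q ∧
    ∀ f, IsMonotoneSubmodular f →
      ENNReal.ofReal (1 - τ) ≤ A.successProb f {r | IsCorrect f γ ε k q r}

theorem learnable_of {n : ℕ} {γ ε k τ : ℝ} {q : ℕ} {Ω : Type} [Fintype Ω] (μ : FinProb Ω)
    (D : Ω → QueryAlg n (OracleJunta n)) (hD : ∀ ω, (D ω).QueriesAtMost q)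
    (h : ∀ f, IsMonotoneSubmodular f →
      μ.P (fun ω => ¬ IsCorrect f γ ε k q ((D ω).run f)) ≤ τ) :
    Learnable n γ ε k τ q := by
  obtain ⟨A, hA, hs⟩ := exists_randQueryAlg μ D hD
  refine ⟨A, hA, fun f hf => ?_⟩
  rw [hs]
  refine ENNReal.ofReal_le_ofReal ?_
  have h1 := h f hf
  rw [P_compl] at h1
  simp only [Set.mem_ofPred_eq]
  linarith

theorem Learnable.mono {n : ℕ} {γ ε k τ τ' : ℝ} {q q' : ℕ} (h : Learnable n γ ε k τ q)
    (hτ : τ ≤ τ') (hq : q ≤ q') : Learnable n γ ε k τ' q' := by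
  obtain ⟨A, hA, hs⟩ := h
  refine ⟨A, fun D hD => (hA D hD).mono hq, fun f hf => ?_⟩
  refine (ENNReal.ofReal_le_ofReal (by linarith)).trans ((hs f hf).trans ?_)
  refine MeasureTheory.measure_mono fun r hr => ?_
  exact ⟨fun x => (hr.1 x).mono hq, hr.2⟩

/-- If the allowed size is at least `n`, the function itself is a junta of the allowed size. -/
theorem learnable_of_le {n : ℕ} {γ ε k : ℝ} (hγ : 0 ≤ γ) (hε : 0 ≤ ε) (hk : n ≤ k) :
    Learnable n γ ε k 0 1 := by
  refine learnable_of (cube n halfI)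
    (fun _ => QueryAlg.done (Finset.univ, fun x => QueryAlg.query x fun v => QueryAlg.done v))
    (fun _ => QueryAlg.queriesAtMost_done _ _) fun f hf => ?_
  have hc : IsCorrect f γ ε k 1
      (Finset.univ, fun x => QueryAlg.query x fun v => QueryAlg.done v) := by
    refine ⟨fun _ _ => le_rfl, ?_, hf, ?_, ?_⟩
    · simpa using hk
    · intro x y hxy
      have : x = y := funext fun i => hxy i (by simp)
      rw [this]
    · rw [IsMultApprox, uniformProb_eq]
      have : (1 : ℝ) ≤ (cube n halfI).P fun x => f x ≤ f x ∧ f x ≤ (1 + γ) * f x := by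
        refine const_le_E _ fun x => (ind_of_true ⟨le_rfl, ?_⟩).ge
        nlinarith [hf.nonneg x]
      simp only [QueryAlg.run]
      linarith
  refine le_of_eq ?_
  rw [P, ← (cube n halfI).E_const 0]
  congr 1
  funext ω
  exact ind_of_false (not_not.2 hc)

/-- If the required success probability `1 - ε` is small in comparison with `γ`, a random constant
will do: the values in the upper half of the range of `f` fall into about `1 / γ` classes of ratio
`1 + γ`, and a random point of large value is unlikely to lie in a class of probability below
`1 - ε`. -/
theorem learnable_of_const {n : ℕ} {γ ε k τ : ℝ} (hγ : 0 < γ) (hγ1 : γ < 1) (hε : ε ≤ 1)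
    (hk : 0 ≤ k) (h : 4 * (1 - ε) / γ ≤ τ) : Learnable n γ ε k τ 3 := by
  classical
  set L := ⌈1 / γ⌉₊ with hLdef
  have hL : 0 < L := Nat.ceil_pos.2 (by positivity)
  have hLge : 1 ≤ L * γ := by
    have := Nat.le_ceil (1 / γ)
    rwa [div_le_iff₀ hγ] at this
  have hLle : (L : ℝ) ≤ 2 / γ := by
    have h1 := Nat.ceil_lt_add_one (show 0 ≤ 1 / γ by positivity)
    have h2 : 1 ≤ 1 / γ := by rw [le_div_iff₀ hγ]; linarith
    have h3 : 2 / γ = 1 / γ + 1 / γ := by ring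
    linarith
  have hpow : 2 ≤ (1 + γ) ^ L := by
    have := one_add_mul_le_pow (a := γ) (by linarith) L
    linarith
  -- the exponent of the scale, as a function of the maximum and of the larger sampled value
  set fit : ℝ → ℝ → ℕ → Prop := fun M a j =>
    j < L ∧ a ≤ M / (1 + γ) ^ j ∧ M / (1 + γ) ^ j ≤ (1 + γ) * a with hfit
  set pick : ℝ → ℝ → ℕ := fun M a => if h : ∃ j, fit M a j then h.choose else 0 with hpick
  have hD : ∀ x : Cube n, ∃ B : QueryAlg n (OracleJunta n), B.QueriesAtMost 3 ∧ ∀ f, B.run f =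
      (∅, fun _ => QueryAlg.done (f ⊤ / (1 + γ) ^ pick (f ⊤) (max (f x) (f xᶜ)))) := by
    intro x
    obtain ⟨B, hB, hr⟩ := QueryAlg.exists_ask (![⊤, x, xᶜ] : Fin 3 → Cube n)
      (fun v => ((∅, fun _ => QueryAlg.done (v 0 / (1 + γ) ^ pick (v 0) (max (v 1) (v 2)))) :
        OracleJunta n))
    exact ⟨B, by simpa using hB, fun f => hr f⟩
  choose D hDq hDr using hD
  refine learnable_of (cube n halfI) D hDq fun f hf => ?_
  set μ := cube n halfI with hμ
  set S : ℕ → Cube n → Prop := fun j x =>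
    f x ≤ f ⊤ / (1 + γ) ^ j ∧ f ⊤ / (1 + γ) ^ j ≤ (1 + γ) * f x with hS
  have hrare : ∀ j, μ.P (fun x => μ.P (S j) < 1 - ε ∧ (S j x ∨ S j xᶜ)) ≤ 2 * (1 - ε) := by
    intro j
    by_cases hj : μ.P (S j) < 1 - ε
    · have h1 : μ.P (fun x => μ.P (S j) < 1 - ε ∧ (S j x ∨ S j xᶜ))
          ≤ μ.P (fun x => S j x ∨ S j xᶜ) := P_mono _ fun x hx => hx.2
      have h2 := μ.P_or_le (S j) fun x => S j xᶜ
      rw [P_cube_compl (S j)] at h2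
      linarith
    · have : μ.P (fun x => μ.P (S j) < 1 - ε ∧ (S j x ∨ S j xᶜ)) = 0 := by
        rw [P, ← μ.E_const 0]
        congr 1
        funext x
        exact ind_of_false fun h => hj h.1
      rw [this]
      linarith
  calc μ.P (fun x => ¬ IsCorrect f γ ε k 3 ((D x).run f))
      ≤ μ.P (fun x => ∃ j ∈ Finset.range L, μ.P (S j) < 1 - ε ∧ (S j x ∨ S j xᶜ)) := by
        refine P_mono _ fun x hx => ?_
        rw [hDr] at hx
        have hex : ∃ j, fit (f ⊤) (max (f x) (f xᶜ)) j := by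
          refine exists_scale hγ hL (max_le (hf.monotone le_top) (hf.monotone le_top)) ?_
          have h1 := top_le_add_compl hf x
          have h2 := le_max_left (f x) (f xᶜ)
          have h3 := le_max_right (f x) (f xᶜ)
          have h4 : 0 ≤ max (f x) (f xᶜ) := (hf.nonneg x).trans h2
          nlinarith
        have hp : fit (f ⊤) (max (f x) (f xᶜ)) (pick (f ⊤) (max (f x) (f xᶜ))) := by
          simp only [hpick]
          rw [dif_pos hex]
          exact hex.choose_spec
        set j := pick (f ⊤) (max (f x) (f xᶜ)) with hj
        refine ⟨j, Finset.mem_range.2 hp.1, ?_, ?_⟩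
        · by_contra! hge
          refine hx ⟨fun _ => QueryAlg.queriesAtMost_done _ _, by simpa using hk, ?_, ?_, ?_⟩
          · refine ⟨fun _ => div_nonneg (hf.nonneg _) (by positivity), fun _ _ _ => le_rfl,
              fun _ _ => le_rfl⟩
          · intro _ _ _; rfl
          · rw [IsMultApprox, uniformProb_eq]
            exact hge
        · rcases max_cases (f x) (f xᶜ) with h5 | h5
          · left
            have := hp.2
            rwa [h5.1] at this
          · right
            have := hp.2
            rwa [h5.1] at this
    _ ≤ ∑ j ∈ Finset.range L, μ.P (fun x => μ.P (S j) < 1 - ε ∧ (S j x ∨ S j xᶜ)) :=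
        P_exists_le _ _ _
    _ ≤ ∑ _j ∈ Finset.range L, 2 * (1 - ε) := Finset.sum_le_sum fun j _ => hrare j
    _ = L * (2 * (1 - ε)) := by rw [Finset.sum_const, Finset.card_range, nsmul_eq_mul]
    _ ≤ 2 / γ * (2 * (1 - ε)) := by gcongr
    _ = 4 * (1 - ε) / γ := by ring
    _ ≤ τ := h

/-- Few of the random values outside `J` are bad ones. -/
theorem P_bad_splice_le {n : ℕ} {f : Cube n → ℝ} {J : Finset (Fin n)} {r η b : ℝ}
    (h : (cube n halfI).E (fun x => (cube n halfI).P fun z =>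
      ¬ Close r (f x) (f (splice J x z))) ≤ η) :
    b * (cube n halfI).P (fun z => b ≤ (cube n halfI).P fun x =>
      ¬ Close r (f x) (f (splice J x z))) ≤ η := by
  refine (mul_P_le_E _ (fun z => P_nonneg _ _) b).trans (le_trans (le_of_eq ?_) h)
  exact E_comm _ _ _

theorem sq_one_add_div_le {γ : ℝ} (h0 : 0 ≤ γ) (h1 : γ ≤ 1) :
    (1 + γ / 8) ^ 2 * (1 + γ / 8) ^ 2 ≤ 1 + γ := by
  have h2 : γ ^ 2 ≤ γ := by nlinarith
  have h3 : γ ^ 3 ≤ γ := by nlinarith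
  have h4 : γ ^ 4 ≤ γ := by nlinarith
  nlinarith

theorem le_P_of_close {n : ℕ} {f g : Cube n → ℝ} (hf : IsMonotoneSubmodular f) {γ b : ℝ}
    (h0 : 0 ≤ γ) (h1 : γ ≤ 1)
    (h : (cube n halfI).P (fun x => ¬ Close ((1 + γ / 8) ^ 2) (f x) (g x)) ≤ b) :
    1 - b ≤ (cube n halfI).P fun x =>
      f x ≤ (1 + γ / 8) ^ 2 * g x ∧ (1 + γ / 8) ^ 2 * g x ≤ (1 + γ) * f x := by
  rw [P_compl] at h
  have : (cube n halfI).P (fun x => Close ((1 + γ / 8) ^ 2) (f x) (g x))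
      ≤ (cube n halfI).P fun x =>
        f x ≤ (1 + γ / 8) ^ 2 * g x ∧ (1 + γ / 8) ^ 2 * g x ≤ (1 + γ) * f x := by
    refine P_mono _ fun x hx => ⟨hx.1, ?_⟩
    calc (1 + γ / 8) ^ 2 * g x ≤ (1 + γ / 8) ^ 2 * ((1 + γ / 8) ^ 2 * f x) :=
          mul_le_mul_of_nonneg_left hx.2 (by positivity)
      _ = (1 + γ / 8) ^ 2 * (1 + γ / 8) ^ 2 * f x := by ring
      _ ≤ (1 + γ) * f x := mul_le_mul_of_nonneg_right (sq_one_add_div_le h0 h1) (hf.nonneg x)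
  linarith

/-- One random choice of the values outside the sampled set succeeds except with probability
`O(ε)`. -/
theorem learnable_of_sample {n m : ℕ} (hm : 0 < m) {γ ε k : ℝ} (hγ : 0 < γ) (hγ1 : γ < 1)
    (hε : 0 < ε) (hε1 : ε < 1)
    (hk : 2560000 / γ ^ 2 * Real.log (16 / (ε ^ 2 / 8)) * Real.log (16 / (γ * (ε ^ 2 / 8))) ≤ k) :
    Learnable n γ ε k (16 * n / m + ε / 8) (2 * (m * n) + 1) := by
  obtain ⟨α, k₀, hpar⟩ := exists_influential_params hγ hγ1 (η := ε ^ 2 / 8) (by positivity)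
    (by nlinarith)
  choose est hestq hestr using fun R : Fin m → Cube n => exists_sampledSet_alg α R
  refine learnable_of ((iid (cube n (sparseI k₀)) m).prod (cube n halfI))
    (fun ω => (est ω.1).bind fun J =>
      QueryAlg.done (spliceOracle J ω.2 ((1 + γ / 8) ^ 2)))
    (fun ω => ((hestq ω.1).bind (q' := 0) fun J => QueryAlg.queriesAtMost_done _ _).mono
      (by omega)) fun f hf => ?_
  refine P_prod_le _ _ (P_not_isInfluentialSet_le hm f α k₀) (by positivity) fun R hR => ?_
  obtain ⟨hcard, hclose⟩ := hpar n f hf _ (not_not.1 hR)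
  have hbad := P_bad_splice_le (b := ε) hclose
  have hsub : (cube n halfI).P (fun z => ¬ IsCorrect f γ ε k (2 * (m * n) + 1)
      (((est R).bind fun J =>
        QueryAlg.done (spliceOracle J z ((1 + γ / 8) ^ 2))).run f))
      ≤ (cube n halfI).P (fun z => ε ≤ (cube n halfI).P fun x =>
      ¬ Close ((1 + γ / 8) ^ 2) (f x) (f (splice (sampledSet f α R) x z))) := by
    refine P_mono _ fun z hz => ?_
    by_contra! hlt
    refine hz ?_
    rw [QueryAlg.run_bind, hestr]
    exact isCorrect_spliceOracle hf (hcard.trans hk) (by positivity) z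
      (le_P_of_close hf hγ.le hγ1.le hlt.le) (by omega)
  refine hsub.trans ?_
  have : ε * (cube n halfI).P (fun z => ε ≤ (cube n halfI).P fun x =>
      ¬ Close ((1 + γ / 8) ^ 2) (f x) (f (splice (sampledSet f α R) x z))) ≤ ε * (ε / 8) := by
    linarith
  exact le_of_mul_le_mul_left this hε

/-- Several random choices of the values outside the sampled set, combined with all scales and
tested. The scales reduce an approximation up to the factor `(1 + γ) ^ L` that succeeds with
probability `1 - b` to one up to the factor `1 + γ` that succeeds with probability `(1 - b) / L`. -/
theorem learnable_of_test {n m N M L : ℕ} (hm : 0 < m) (hN : 0 < N) (hM : 0 < M) (hL : 0 < L)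
    {γ ε k η b acc : ℝ} (hγ : 0 < γ) (hγL : (1 + γ) ^ L < 2) (hη : 0 < η) (hη1 : η < 1)
    (hb : 4 * η ≤ b) (hacc : 0 < acc) (hbL : 1 - ε + 2 * acc ≤ (1 - b) / L)
    (hk : 2560000 / ((1 + γ) ^ L - 1) ^ 2 * Real.log (16 / η)
      * Real.log (16 / (((1 + γ) ^ L - 1) * η)) ≤ k) :
    Learnable n γ ε k (16 * n / m + ((1 / 4) ^ N + (N * L : ℕ) / (M * acc ^ 2)))
      (2 * (m * n) + (M + M * (N * L))) := by
  set γ' := (1 + γ) ^ L - 1 with hγ'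
  have hγ'0 : 0 < γ' := sub_pos.2 (one_lt_pow₀ (by linarith) hL.ne')
  have hγ'1 : γ' < 1 := by linarith
  have hb0 : 0 < b := by linarith
  obtain ⟨α, k₀, hpar⟩ := exists_influential_params hγ'0 hγ'1 hη hη1
  have : Nonempty (Fin N × Fin L) := ⟨(⟨0, hN⟩, ⟨0, hL⟩)⟩
  choose est hestq hestr using fun R : Fin m → Cube n => exists_sampledSet_alg α R
  choose sel hselq hsel using fun (J : Finset (Fin n)) (Z : Fin N → Cube n) =>
    exists_select_alg hM J (fun c : Fin N × Fin L => Z c.1)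
      (fun c => (1 + γ' / 8) ^ 2 / (1 + γ) ^ (c.2 : ℕ)) (fun c => by positivity) γ ε k acc hacc
  have hcardκ : Fintype.card (Fin N × Fin L) = N * L := by simp
  refine learnable_of ((iid (cube n (sparseI k₀)) m).prod
      ((iid (cube n halfI) N).prod (iid (cube n halfI) M)))
    (fun ω => (est ω.1).bind fun J => sel J ω.2.1 ω.2.2)
    (fun ω => (hestq ω.1).bind fun J => by rw [← hcardκ]; exact hselq J _ _) fun f hf => ?_
  refine P_prod_le _ _ (P_not_isInfluentialSet_le hm f α k₀) (by positivity) fun R hR => ?_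
  obtain ⟨hcard, hclose⟩ := hpar n f hf _ (not_not.1 hR)
  simp only [QueryAlg.run_bind, hestr]
  set J := sampledSet f α R with hJ
  set bad : Cube n → Prop := fun z => b ≤ (cube n halfI).P fun x =>
      ¬ Close ((1 + γ' / 8) ^ 2) (f x) (f (splice J x z)) with hbad
  have hPbad : (cube n halfI).P bad ≤ 1 / 4 := by
    have h1 : b * (cube n halfI).P bad ≤ b * (1 / 4) :=
      (P_bad_splice_le (b := b) hclose).trans (by linarith)
    exact le_of_mul_le_mul_left h1 hb0
  refine P_prod_le _ _ (S := fun Z => ∀ l, bad (Z l)) ?_ (by positivity) fun Z hZ => ?_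
  · rw [P_iid_forall]
    exact pow_le_pow_left₀ (P_nonneg _ _) hPbad _
  · push Not at hZ
    obtain ⟨l, hl⟩ := hZ
    have hl' := le_P_of_close hf hγ'0.le hγ'1.le (not_le.1 hl).le
    rw [show 1 + γ' = (1 + γ) ^ L by rw [hγ']; ring] at hl'
    obtain ⟨j, hj⟩ := exists_score_ge hγ hL hl'
    rw [← hcardκ]
    refine hsel J Z f hf (hcard.trans hk) ⟨(l, j), hbL.trans (hj.trans (le_of_eq ?_))⟩ _ ?_
    · congr 1
      funext x
      ring
    · have := Nat.le_add_right M (M * Fintype.card (Fin N × Fin L))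
      omega

/-- Constants at all scales, tested. -/
theorem learnable_of_test_const {n M L : ℕ} (hM : 0 < M) (hL : 0 < L)
    {γ ε k acc : ℝ} (hγ : 0 < γ) (hγL : 2 ≤ (1 + γ) ^ L) (hacc : 0 < acc)
    (hbL : 1 - ε + 2 * acc ≤ 1 / 2 / L) (hk : 0 ≤ k) :
    Learnable n γ ε k (L / (M * acc ^ 2)) (M + M * L) := by
  have : Nonempty (Fin L) := ⟨⟨0, hL⟩⟩
  obtain ⟨sel, hselq, hsel⟩ := exists_select_alg hM (∅ : Finset (Fin n))
      (fun _ : Fin L => (⊤ : Cube n))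
      (fun j => 1 / (1 + γ) ^ (j : ℕ)) (fun j => by positivity) γ ε k acc hacc
  rw [Fintype.card_fin] at hselq
  refine learnable_of (iid (cube n halfI) M) sel hselq fun f hf => ?_
  obtain ⟨j, hj⟩ := exists_score_ge (f := f) (g := fun _ => f ⊤) (σ := 1 / 2) hγ hL (by
    refine (half_le_P_top hf).trans (P_mono _ fun x hx => ⟨hx.1, hx.2.trans ?_⟩)
    exact mul_le_mul_of_nonneg_right hγL (hf.nonneg x))
  have hq := hsel f hf (by simpa using hk) ⟨j, hbL.trans (hj.trans (le_of_eq ?_))⟩ (M + M * L)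
    (by omega)
  · rwa [Fintype.card_fin] at hq
  · congr 1
    funext x
    have : splice ∅ x (⊤ : Cube n) = ⊤ := by funext i; simp [splice]
    rw [this]
    ring

/-! ### The size of the junta and the number of queries -/

theorem one_sub_le_log_one_div {x : ℝ} (hx : 0 < x) : 1 - x ≤ Real.log (1 / x) := by
  rw [one_div, Real.log_inv]
  linarith [Real.log_le_sub_one_of_pos hx]

theorem log_128_le : Real.log 128 ≤ 5 := by
  rw [show (128 : ℝ) = 2 ^ 7 by norm_num, Real.log_pow]
  have := Real.log_two_lt_d9
  push_cast
  linarith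

theorem log_one_div_mul {γ ε : ℝ} (hγ : 0 < γ) (hε : 0 < ε) :
    Real.log (1 / (γ * ε)) = Real.log (1 / γ) + Real.log (1 / ε) := by
  rw [one_div, mul_inv, Real.log_mul (by positivity) (by positivity), one_div, one_div]

theorem log_one_div_nonneg {x : ℝ} (hx : 0 < x) (hx1 : x ≤ 1) : 0 ≤ Real.log (1 / x) := by
  linarith [one_sub_le_log_one_div hx]

/-- The absolute constant in the size of the junta. -/
def juntaConst : ℝ := 2560000 * 5000

theorem juntaSize_nonneg {γ ε : ℝ} (hγ : 0 < γ) (hγ1 : γ < 1) (hε : 0 < ε) (hε1 : ε < 1) :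
    0 ≤ juntaSize juntaConst γ ε := by
  have h1 := log_one_div_nonneg hγ hγ1.le
  have h2 := log_one_div_nonneg hε hε1.le
  unfold juntaSize
  rw [log_one_div_mul hγ hε]
  unfold juntaConst
  positivity

/-- The size is sufficient for the accuracy `γ` and the failure probability `ε ^ 2 / 8`, unless
`ε` is close to `1`. -/
theorem size_le_juntaSize {γ ε : ℝ} (hγ : 0 < γ) (hγ1 : γ < 1) (hε : 0 < ε) (hε1 : ε ≤ 7 / 8) :
    2560000 / γ ^ 2 * Real.log (16 / (ε ^ 2 / 8)) * Real.log (16 / (γ * (ε ^ 2 / 8)))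
      ≤ juntaSize juntaConst γ ε := by
  have h1 := log_one_div_nonneg hγ hγ1.le
  have h2 := one_sub_le_log_one_div hε
  have h3 := log_128_le
  have e1 : Real.log (16 / (ε ^ 2 / 8)) = Real.log 128 + 2 * Real.log (1 / ε) := by
    rw [show 16 / (ε ^ 2 / 8) = 128 * (1 / ε) ^ 2 by field_simp; norm_num,
      Real.log_mul (by norm_num) (by positivity), Real.log_pow]
    norm_num
  have e2 : Real.log (16 / (γ * (ε ^ 2 / 8)))
      = Real.log 128 + (Real.log (1 / γ) + 2 * Real.log (1 / ε)) := by
    rw [show 16 / (γ * (ε ^ 2 / 8)) = 128 * (1 / γ * (1 / ε) ^ 2) by field_simp; norm_num,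
      Real.log_mul (by norm_num) (by positivity), Real.log_mul (by positivity) (by positivity),
      Real.log_pow]
    norm_num
  unfold juntaSize
  rw [log_one_div_mul hγ hε, e1, e2]
  set a := Real.log (1 / γ)
  set b := Real.log (1 / ε)
  have hb : 1 / 8 ≤ b := by linarith
  have h128 : 0 ≤ Real.log 128 := Real.log_nonneg (by norm_num)
  calc 2560000 / γ ^ 2 * (Real.log 128 + 2 * b) * (Real.log 128 + (a + 2 * b))
      ≤ 2560000 / γ ^ 2 * (42 * b) * (42 * (a + b)) := by
        gcongr <;> linarith
    _ = 2560000 * 1764 * (1 / γ ^ 2 * (a + b) * b) := by ring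
    _ ≤ 2560000 * 5000 * (1 / γ ^ 2 * (a + b) * b) := by
        gcongr; norm_num
    _ = _ := by unfold juntaConst; ring

/-- The size is sufficient for a coarser accuracy `γ'` and constant failure probability, if the
required success probability `1 - ε` is at least of the order of `γ / γ'`. -/
theorem size_le_juntaSize_of_coarse {γ γ' ε : ℝ} (hγ : 0 < γ) (hγ1 : γ ≤ 1 / 2) (hε : 7 / 8 ≤ ε)
    (hε1 : ε < 1) (hγγ' : γ ≤ γ') (h : γ ≤ 8 * (1 - ε) * γ') :
    2560000 / γ' ^ 2 * Real.log (16 / (1 / 8)) * Real.log (16 / (γ' * (1 / 8)))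
      ≤ juntaSize juntaConst γ ε := by
  have hε0 : 0 < ε := by linarith
  have hγ' : 0 < γ' := by linarith
  have h2 := one_sub_le_log_one_div hε0
  have h3 := log_128_le
  have h128 : 0 ≤ Real.log 128 := Real.log_nonneg (by norm_num)
  have hlogγ : 1 / 2 ≤ Real.log (1 / γ) := by
    have := one_sub_le_log_one_div hγ
    linarith
  have e1 : Real.log (16 / (1 / 8)) = Real.log 128 := by norm_num
  have e2 : Real.log (16 / (γ' * (1 / 8))) ≤ 5 + Real.log (1 / γ) := by
    calc Real.log (16 / (γ' * (1 / 8))) ≤ Real.log (128 * (1 / γ)) := by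
          refine Real.log_le_log (by positivity) ?_
          rw [div_le_iff₀ (by positivity)]
          calc (16 : ℝ) = 128 * (1 / γ) * (γ * (1 / 8)) := by field_simp; norm_num
            _ ≤ 128 * (1 / γ) * (γ' * (1 / 8)) := by gcongr
      _ = Real.log 128 + Real.log (1 / γ) := Real.log_mul (by norm_num) (by positivity)
      _ ≤ _ := by linarith
  have hinv : 1 / γ' ^ 2 ≤ 64 * (1 - ε) ^ 2 * (1 / γ ^ 2) := by
    rw [mul_one_div, div_le_div_iff₀ (by positivity) (by positivity)]
    nlinarith [mul_le_mul h h hγ.le (by nlinarith)]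
  have hb0 : 0 ≤ Real.log (1 / ε) := by linarith
  unfold juntaSize
  rw [log_one_div_mul hγ hε0, e1]
  set a := Real.log (1 / γ)
  set b := Real.log (1 / ε)
  have hδ : (1 - ε) ^ 2 ≤ b / 8 := by nlinarith
  calc 2560000 / γ' ^ 2 * Real.log 128 * Real.log (16 / (γ' * (1 / 8)))
      ≤ 2560000 / γ' ^ 2 * Real.log 128 * (5 + a) := by gcongr
    _ ≤ 2560000 / γ' ^ 2 * 5 * (5 + a) := by gcongr
    _ ≤ 2560000 / γ' ^ 2 * 5 * (11 * a) := by gcongr; linarith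
    _ = 2560000 * 55 * a * (1 / γ' ^ 2) := by ring
    _ ≤ 2560000 * 55 * a * (64 * (b / 8) * (1 / γ ^ 2)) := by
        refine mul_le_mul_of_nonneg_left (hinv.trans ?_) (by positivity)
        gcongr
    _ = 2560000 * 440 * (1 / γ ^ 2 * a * b) := by ring
    _ ≤ 2560000 * 5000 * (1 / γ ^ 2 * (a + b) * b) := by
        gcongr
        · norm_num
        · linarith
    _ = _ := by unfold juntaConst; ring

/-- If neither the whole function nor a random constant is admissible, then the required success
probability `1 - ε` is bounded below by an inverse polynomial. -/
theorem le_one_sub_of_juntaSize_lt {n d : ℕ} {γ ε : ℝ} (hn : 0 < n) (hγ : 0 < γ) (hγ1 : γ < 1)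
    (hε : 0 < ε) (hε1 : ε < 1) (hk : juntaSize juntaConst γ ε < n)
    (hT : 1 / ((n : ℝ) + 1) ^ d < 4 * (1 - ε) / γ) :
    1 / (4 * ((n : ℝ) + 1) ^ (2 * d + 1)) ≤ 1 - ε := by
  set x : ℝ := (n : ℝ) + 1 with hx
  have hn1 : (1 : ℝ) ≤ n := by exact_mod_cast hn
  have hx2 : 2 ≤ x := by linarith
  have hx0 : 0 < x := by linarith
  have hpow : 1 ≤ x ^ d := one_le_pow₀ (by linarith)
  rw [div_lt_div_iff₀ (by positivity) hγ, one_mul] at hT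
  have hγx : 1 ≤ γ * x ^ (d + 1) := by
    rcases le_total (1 / 2) γ with h | h
    · have : 2 ≤ x ^ (d + 1) := by rw [pow_succ]; nlinarith
      nlinarith
    · have hlogγ : 1 / 2 ≤ Real.log (1 / γ) := by
        have := one_sub_le_log_one_div hγ
        linarith
      have hlogε := one_sub_le_log_one_div hε
      unfold juntaSize at hk
      rw [log_one_div_mul hγ hε] at hk
      have h1 : juntaConst * (1 / γ ^ 2) * (1 / 2) * (1 - ε) < n := by
        refine lt_of_le_of_lt ?_ hk
        have hlogε0 : 0 ≤ Real.log (1 / ε) := by linarith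
        unfold juntaConst
        gcongr
        · linarith
      have h2 : juntaConst * (1 - ε) < 2 * n * γ ^ 2 := by
        have : juntaConst * (1 / γ ^ 2) * (1 / 2) * (1 - ε)
            = juntaConst * (1 - ε) / (2 * γ ^ 2) := by field_simp
        rw [this, div_lt_iff₀ (by positivity)] at h1
        linarith
      have h3 : 4 * (1 - ε) ≤ x * γ ^ 2 := by
        unfold juntaConst at h2
        nlinarith [sq_nonneg γ]
      have h4 : γ * 1 < γ * (γ * x ^ (d + 1)) := by
        calc γ * 1 < 4 * (1 - ε) * x ^ d := by linarith
          _ ≤ x * γ ^ 2 * x ^ d := by gcongr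
          _ = γ * (γ * x ^ (d + 1)) := by ring
      exact (lt_of_mul_lt_mul_left h4 hγ.le).le
  rw [div_le_iff₀ (by positivity)]
  calc 1 ≤ γ * x ^ (d + 1) := hγx
    _ ≤ 4 * (1 - ε) * x ^ d * x ^ (d + 1) := by gcongr
    _ = (1 - ε) * (4 * x ^ (2 * d + 1)) := by ring

set_option maxHeartbeats 400000 in
/-- Approximating juntas can be learned with a polynomial number of queries. -/
theorem exists_polynomial_learnable (d : ℕ) : ∃ p : Polynomial ℕ, ∀ n : ℕ,
    ∀ γ ∈ Set.Ioo (0 : ℝ) 1, ∀ ε ∈ Set.Ioo (0 : ℝ) 1,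
      Learnable n γ ε (juntaSize juntaConst γ ε) (1 / ((n : ℝ) + 1) ^ d) (p.eval n) := by
  obtain ⟨K, hK⟩ : ∃ K : ℕ, K = 128 + 256 * (d + 1) + 256 * (d + 1) * (d + 1) := ⟨_, rfl⟩
  have hK3 : 129 ≤ K := by rw [hK]; nlinarith
  refine ⟨Polynomial.C K * (Polynomial.X + 1) ^ (9 * d + 6), ?_⟩
  rintro n γ ⟨hγ, hγ1⟩ ε ⟨hε, hε1⟩
  have heval : (Polynomial.C K * (Polynomial.X + 1) ^ (9 * d + 6) : Polynomial ℕ).eval n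
      = K * (n + 1) ^ (9 * d + 6) := by simp
  rw [heval]
  set k := juntaSize juntaConst γ ε with hk
  have hk0 : 0 ≤ k := juntaSize_nonneg hγ hγ1 hε hε1
  set x : ℝ := (n : ℝ) + 1 with hx
  have hx1 : 1 ≤ x := by have : (0 : ℝ) ≤ n := Nat.cast_nonneg n; linarith
  have hx0 : 0 < x := by linarith
  have hpowle : ∀ {a b : ℕ}, a ≤ b → (n + 1) ^ a ≤ (n + 1) ^ b := fun h =>
    Nat.pow_le_pow_right (Nat.succ_pos n) h
  have hpowle' : ∀ {a b : ℕ}, a ≤ b → x ^ a ≤ x ^ b := fun h => pow_le_pow_right₀ hx1 h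
  have hone : 1 ≤ (n + 1) ^ (9 * d + 6) := Nat.one_le_pow _ _ (Nat.succ_pos n)
  have hK3P : 3 ≤ K * (n + 1) ^ (9 * d + 6) :=
    le_trans (by omega : 3 ≤ K) (Nat.le_mul_of_pos_right _ hone)
  have hdn : 1 ≤ (d + 1) * (n + 1) := Nat.succ_le_of_lt (by positivity)
  have hε2 : ε ^ 2 ≤ ε := by rw [sq]; exact mul_le_of_le_one_left hε.le hε1.le
  -- the whole function
  by_cases hkn : (n : ℝ) ≤ k
  · refine (learnable_of_le hγ.le hε.le hkn).mono (by positivity) ?_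
    omega
  push Not at hkn
  have hn : 0 < n := by
    have : (0 : ℝ) < n := lt_of_le_of_lt hk0 hkn
    exact_mod_cast this
  -- a random constant
  by_cases hT : 4 * (1 - ε) / γ ≤ 1 / x ^ d
  · refine (learnable_of_const hγ hγ1 hε1.le hk0 hT).mono le_rfl hK3P
  push Not at hT
  have hδ := le_one_sub_of_juntaSize_lt hn hγ hγ1 hε hε1 hkn hT
  rw [← hx] at hδ
  -- the number of samples for the influential coordinates; each stage may fail with probability
  -- a quarter of the admissible one
  obtain ⟨m, hm⟩ : ∃ m : ℕ, m = 64 * (n + 1) ^ (d + 1) := ⟨_, rfl⟩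
  have hm0 : 0 < m := by rw [hm]; positivity
  have hmτ : 16 * n / (m : ℝ) ≤ 1 / (4 * x ^ d) := by
    rw [hm, div_le_div_iff₀ (by positivity) (by positivity)]
    push_cast
    rw [← hx]
    calc 16 * (n : ℝ) * (4 * x ^ d) ≤ 16 * x * (4 * x ^ d) := by gcongr; linarith
      _ = 1 * (64 * x ^ (d + 1)) := by ring
  have hmq : 2 * (m * n) ≤ 128 * (n + 1) ^ (d + 2) := by
    calc 2 * (m * n) ≤ 2 * (m * (n + 1)) := by gcongr; omega
      _ = 128 * (n + 1) ^ (d + 2) := by rw [hm]; ring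
  -- a single random choice
  by_cases hS : ε ≤ 1 / x ^ (d + 1)
  · have hε78 : ε ≤ 7 / 8 := by
      refine hS.trans ?_
      have h2 : 2 ≤ x := by
        have : (1 : ℝ) ≤ n := by exact_mod_cast hn
        linarith
      have : x ≤ x ^ (d + 1) := le_self_pow₀ hx1 (by omega)
      rw [div_le_iff₀ (by positivity)]
      linarith
    refine (learnable_of_sample (n := n) hm0 hγ hγ1 hε hε1
      (size_le_juntaSize hγ hγ1 hε hε78)).mono ?_ ?_
    · have h1 : ε ≤ 1 / x ^ d := hS.trans
        (one_div_le_one_div_of_le (by positivity) (hpowle' (by omega)))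
      have h2 : 1 / (4 * x ^ d) = 1 / x ^ d / 4 := by field_simp
      rw [h2] at hmτ
      have : 0 < 1 / x ^ d := by positivity
      linarith
    · have := hpowle (show d + 2 ≤ 9 * d + 6 by omega)
      calc 2 * (m * n) + 1 ≤ 128 * (n + 1) ^ (9 * d + 6) + 1 * (n + 1) ^ (9 * d + 6) := by
            linarith
        _ ≤ K * (n + 1) ^ (9 * d + 6) := by rw [← add_mul]; gcongr
  push Not at hS
  -- everything is bounded below by inverse polynomials, and candidates can be tested
  set acc : ℝ := 1 / (8 * x ^ (2 * d + 1)) with hacc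
  have hacc0 : 0 < acc := by positivity
  have hacc1 : 2 * acc ≤ 1 - ε := by
    refine le_trans (le_of_eq ?_) hδ
    rw [hacc]; field_simp; norm_num
  have hacc2 : 4 * acc ≤ ε := by
    refine le_trans ?_ hS.le
    rw [hacc, mul_one_div, div_le_div_iff₀ (by positivity) (by positivity)]
    have := hpowle' (show d + 1 ≤ 2 * d + 1 by omega)
    have : 0 < x ^ (2 * d + 1) := by positivity
    linarith
  obtain ⟨M, hM⟩ : ∃ M : ℕ, M = 256 * (d + 1) * (n + 1) ^ (7 * d + 4) := ⟨_, rfl⟩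
  have hM0 : 0 < M := by rw [hM]; positivity
  obtain ⟨N, hN⟩ : ∃ N : ℕ, N = d * n + 1 := ⟨_, rfl⟩
  have hN0 : 0 < N := by omega
  have hNle : N ≤ (d + 1) * (n + 1) := by
    have : (d + 1) * (n + 1) = d * n + 1 + (d + n) := by ring
    omega
  have hNτ : (1 / 4 : ℝ) ^ N ≤ 1 / (4 * x ^ d) := by
    rw [div_pow, one_pow]
    refine one_div_le_one_div_of_le (by positivity) ?_
    have h1 : x ≤ 4 ^ n := by
      have : n + 1 ≤ 4 ^ n := Nat.lt_pow_self (by norm_num)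
      rw [hx]
      exact_mod_cast this
    calc 4 * x ^ d ≤ 4 * (4 ^ n) ^ d := by gcongr
      _ = 4 ^ N := by rw [hN, ← pow_mul, pow_succ, mul_comm n d]; ring
  have hMτ : ∀ L : ℕ, (L : ℝ) ≤ x ^ (2 * d + 1) → ∀ N' : ℕ, N' ≤ (d + 1) * (n + 1) →
      (N' * L : ℕ) / (M * acc ^ 2) ≤ 1 / (4 * x ^ d) := by
    intro L hL N' hN'
    have hN'' : (N' : ℝ) ≤ (d + 1) * x := by
      rw [hx]; exact_mod_cast hN'
    rw [div_le_div_iff₀ (by positivity) (by positivity), hacc, hM]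
    push_cast
    rw [← hx]
    calc (N' : ℝ) * L * (4 * x ^ d) ≤ (d + 1) * x * x ^ (2 * d + 1) * (4 * x ^ d) := by gcongr
      _ = 1 * (256 * (d + 1) * x ^ (7 * d + 4) * (1 / (8 * x ^ (2 * d + 1))) ^ 2) := by
        field_simp
        ring
  have hMq : ∀ L : ℕ, L ≤ (n + 1) ^ (2 * d + 1) → ∀ N' : ℕ, N' ≤ (d + 1) * (n + 1) →
      2 * (m * n) + (M + M * (N' * L)) ≤ K * (n + 1) ^ (9 * d + 6) := by
    intro L hL N' hN'
    have h1 := hpowle (show d + 2 ≤ 9 * d + 6 by omega)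
    have h2 := hpowle (show 7 * d + 4 ≤ 9 * d + 6 by omega)
    calc 2 * (m * n) + (M + M * (N' * L))
        ≤ 128 * (n + 1) ^ (d + 2) + (M + M * ((d + 1) * (n + 1) * (n + 1) ^ (2 * d + 1))) := by
          gcongr
      _ = 128 * (n + 1) ^ (d + 2) + (256 * (d + 1) * (n + 1) ^ (7 * d + 4)
            + 256 * (d + 1) * (d + 1) * (n + 1) ^ (9 * d + 6)) := by rw [hM]; ring
      _ ≤ 128 * (n + 1) ^ (9 * d + 6) + (256 * (d + 1) * (n + 1) ^ (9 * d + 6)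
            + 256 * (d + 1) * (d + 1) * (n + 1) ^ (9 * d + 6)) := by gcongr
      _ = K * (n + 1) ^ (9 * d + 6) := by rw [hK]; ring
  have hsum : 1 / (4 * x ^ d) + (1 / (4 * x ^ d) + 1 / (4 * x ^ d)) ≤ 1 / x ^ d := by
    have h2 : 1 / (4 * x ^ d) = 1 / x ^ d / 4 := by field_simp
    have : 0 < 1 / x ^ d := by positivity
    rw [h2]
    linarith
  rcases le_or_gt ε (7 / 8) with hε78 | hε78
  · refine (learnable_of_test (n := n) (L := 1) hm0 hN0 hM0 one_pos
      (η := ε ^ 2 / 8) (b := ε / 2) hγ (by linarith) (by positivity) (by linarith) (by linarith)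
      hacc0 (by push_cast; linarith)
      (by simpa only [pow_one, add_sub_cancel_left] using
        size_le_juntaSize hγ hγ1 hε hε78)).mono ?_ ?_
    · exact (add_le_add hmτ (add_le_add hNτ
        (hMτ 1 (by simpa using one_le_pow₀ hx1) N hNle))).trans hsum
    · exact hMq 1 (Nat.one_le_pow _ _ (Nat.succ_pos n)) N hNle
  · set δ := 1 - ε with hδdef
    have hδ0 : 0 < δ := by linarith
    set L : ℕ := ⌊1 / (4 * δ)⌋₊ with hL
    have hLle : (L : ℝ) ≤ 1 / (4 * δ) := Nat.floor_le (by positivity)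
    have h2 : 2 ≤ 1 / (4 * δ) := by rw [le_div_iff₀ (by positivity)]; linarith
    have hL2 : 2 ≤ L := Nat.le_floor (by exact_mod_cast h2)
    have hL0 : 0 < L := by omega
    have hLge : 1 / (8 * δ) ≤ L := by
      have h3 := Nat.lt_floor_add_one (1 / (4 * δ))
      have h4 : 1 / (4 * δ) = 1 / (8 * δ) + 1 / (8 * δ) := by field_simp; norm_num
      rw [← hL] at h3
      linarith
    have hLx : (L : ℝ) ≤ x ^ (2 * d + 1) := by
      refine hLle.trans ?_
      rw [div_le_iff₀ (by positivity)]
      rw [div_le_iff₀ (by positivity)] at hδ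
      linarith
    have hLx' : L ≤ (n + 1) ^ (2 * d + 1) := by
      rw [hx] at hLx
      exact_mod_cast hLx
    have hLpos : (0 : ℝ) < L := by exact_mod_cast hL0
    have hhalf : δ + 2 * acc ≤ 1 / 2 / L := by
      rw [le_div_iff₀ hLpos]
      have h5 : L * (4 * δ) ≤ 1 := by rwa [le_div_iff₀ (by positivity)] at hLle
      have h6 : (δ + 2 * acc) * L ≤ 2 * δ * L := by gcongr; linarith
      linarith
    rcases le_or_gt 2 ((1 + γ) ^ L) with hγL | hγL
    · refine (learnable_of_test_const hM0 hL0 hγ hγL hacc0 hhalf hk0).mono ?_ ?_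
      · have h7 := hMτ L hLx 1 hdn
        rw [one_mul] at h7
        have : 0 < 1 / (4 * x ^ d) := by positivity
        linarith
      · have := hMq L hLx' 1 hdn
        rw [one_mul] at this
        omega
    · have hbern := one_add_mul_le_pow (a := γ) (by linarith) L
      have hL2' : (2 : ℝ) ≤ L := by exact_mod_cast hL2
      have hLγ : 2 * γ ≤ L * γ := by gcongr
      have hγ2 : γ ≤ 1 / 2 := by linarith
      refine (learnable_of_test (n := n) hm0 hN0 hM0 hL0
        (η := 1 / 8) (b := 1 / 2) hγ hγL (by norm_num) (by norm_num) (by norm_num)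
        hacc0 (by rw [← hδdef]; refine hhalf.trans (le_of_eq ?_); norm_num)
        (size_le_juntaSize_of_coarse hγ hγ2 hε78.le hε1 (by linarith) ?_)).mono ?_ ?_
      · rw [← hδdef]
        rw [div_le_iff₀ (by positivity)] at hLge
        have h8 : L * γ ≤ (1 + γ) ^ L - 1 := by linarith
        calc γ = 1 * γ := (one_mul γ).symm
          _ ≤ L * (8 * δ) * γ := by gcongr
          _ = 8 * δ * (L * γ) := by ring
          _ ≤ 8 * δ * ((1 + γ) ^ L - 1) := by gcongr
      · exact (add_le_add hmτ (add_le_add hNτ (hMτ L hLx N hNle))).trans hsum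
      · exact hMq L hLx' N hNle

/-! ### Existence and explicit output -/

/-- A learner with positive success probability witnesses that an approximating junta exists. -/
theorem Learnable.exists_isJuntaApprox {n : ℕ} {γ ε k τ : ℝ} {q : ℕ}
    (h : Learnable n γ ε k τ q) (hτ : τ < 1) {f : Cube n → ℝ} (hf : IsMonotoneSubmodular f) :
    ∃ J h, IsJuntaApprox f γ ε k J h := by
  obtain ⟨A, _, hs⟩ := h
  by_contra! hcon
  have hempty : {D : QueryAlg n (OracleJunta n) | D.run f ∈ {r | IsCorrect f γ ε k q r}} = ∅ := by
    ext D
    simp only [Set.mem_ofPred_eq, Set.mem_empty_iff_false, iff_false]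
    exact fun hD => hcon _ _ hD.2
  have h1 := hs f hf
  rw [RandQueryAlg.successProb, hempty, MeasureTheory.measure_empty] at h1
  have := ENNReal.ofReal_pos.2 (sub_pos.2 hτ)
  exact absurd h1 (not_le.2 this)

/-- A procedure for the values of a junta is turned into an explicit function by computing the
values at all settings of the relevant variables. -/
theorem exists_tabulate_alg {n c q : ℕ} (r : OracleJunta n) (hc : r.1.card ≤ c)
    (hq : ∀ x, (r.2 x).QueriesAtMost q) :
    ∃ B : QueryAlg n (ExplicitJunta n), B.QueriesAtMost (2 ^ c * q) ∧
      ∀ f, DependsOn (fun x => (r.2 x).run f) (r.1 : Set (Fin n)) →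
        B.run f = (r.1, fun x => (r.2 x).run f) := by
  obtain ⟨J, o⟩ := r
  obtain ⟨B, hB, hr⟩ := QueryAlg.exists_collect
    (fun t : J → Bool => o fun i => if h : i ∈ J then t ⟨i, h⟩ else false) (q := q)
    fun t => hq _
  refine ⟨B.bind fun v => QueryAlg.done (J, fun x => v fun i => x i), ?_, fun f hdep => ?_⟩
  · refine (hB.bind (q' := 0) fun v => QueryAlg.queriesAtMost_done _ _).mono ?_
    rw [add_zero]
    refine Nat.mul_le_mul_right q ?_
    simpa using Nat.pow_le_pow_right (n := 2) (by norm_num) hc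
  · rw [QueryAlg.run_bind, hr]
    simp only [QueryAlg.run, Prod.mk.injEq, true_and]
    funext x
    refine hdep fun i hi => ?_
    have hi' : i ∈ J := hi
    simp [hi']

/-- Learning in explicit form. -/
theorem Learnable.explicit {n : ℕ} {γ ε k τ : ℝ} {q : ℕ} (h : Learnable n γ ε k τ q) :
    ∃ A : RandQueryAlg n (ExplicitJunta n), A.QueriesAtMost ((1 + 2 ^ ⌊k⌋₊) * q) ∧
      ∀ f : Cube n → ℝ, IsMonotoneSubmodular f →
        ENNReal.ofReal (1 - τ) ≤ A.successProb f {r | IsJuntaApprox f γ ε k r.1 r.2} := by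
  classical
  obtain ⟨A, hA, hs⟩ := h
  have hT : ∀ r : OracleJunta n, ∃ B : QueryAlg n (ExplicitJunta n),
      B.QueriesAtMost (2 ^ ⌊k⌋₊ * q) ∧
      (r.1.card ≤ ⌊k⌋₊ → (∀ x, (r.2 x).QueriesAtMost q) → ∀ f,
        DependsOn (fun x => (r.2 x).run f) (r.1 : Set (Fin n)) →
        B.run f = (r.1, fun x => (r.2 x).run f)) := by
    intro r
    by_cases hr : r.1.card ≤ ⌊k⌋₊ ∧ ∀ x, (r.2 x).QueriesAtMost q
    · obtain ⟨B, hB, hrun⟩ := exists_tabulate_alg r hr.1 hr.2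
      exact ⟨B, hB, fun _ _ => hrun⟩
    · exact ⟨QueryAlg.done (∅, 0), QueryAlg.queriesAtMost_done _ _,
        fun h1 h2 => absurd ⟨h1, h2⟩ hr⟩
  choose T hTq hTr using hT
  refine ⟨A.map fun D => D.bind T, ?_, fun f hf => (hs f hf).trans ?_⟩
  · intro D' hD'
    obtain ⟨D, hD, rfl⟩ := (PMF.mem_support_map_iff _ _ _).1 hD'
    refine ((hA D hD).bind hTq).mono (le_of_eq ?_)
    ring
  · rw [RandQueryAlg.successProb, RandQueryAlg.successProb, PMF.toOuterMeasure_map_apply]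
    refine MeasureTheory.measure_mono fun D hD => ?_
    obtain ⟨h1, h2⟩ : IsCorrect f γ ε k q (D.run f) := hD
    change IsJuntaApprox f γ ε k ((D.bind T).run f).1 ((D.bind T).run f).2
    rw [QueryAlg.run_bind, hTr _ (Nat.le_floor h2.card_le) h1 f h2.dependsOn]
    exact h2

/-- There is an absolute constant `C` for which the following three assertions hold: existence of
the approximating junta; finding it by `poly(n)` value queries, uniformly in `γ` and `ε`, in a
form whose values are themselves computed by `poly(n)` queries; finding it as an explicit function
by `poly(n)` queries when `γ` and `ε` are fixed. "With high probability" is probability at least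
`1 - 1 / (n + 1) ^ d`, where `d` is arbitrary. -/
theorem theorem2 :
    ∃ C : ℝ, 0 < C ∧
      (∀ (n : ℕ) (f : Cube n → ℝ), IsMonotoneSubmodular f →
        ∀ γ ∈ Set.Ioo (0 : ℝ) 1, ∀ ε ∈ Set.Ioo (0 : ℝ) 1,
          ∃ (J : Finset (Fin n)) (h : Cube n → ℝ),
            IsJuntaApprox f γ ε (juntaSize C γ ε) J h) ∧
      (∀ d : ℕ, ∃ p : Polynomial ℕ,
        ∀ n : ℕ, ∀ γ ∈ Set.Ioo (0 : ℝ) 1, ∀ ε ∈ Set.Ioo (0 : ℝ) 1,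
          ∃ A : RandQueryAlg n (OracleJunta n),
            A.QueriesAtMost (p.eval n) ∧
            ∀ f : Cube n → ℝ, IsMonotoneSubmodular f →
              ENNReal.ofReal (1 - 1 / ((n : ℝ) + 1) ^ d) ≤
                A.successProb f
                  {r | (∀ x, (r.2 x).QueriesAtMost (p.eval n)) ∧
                    IsJuntaApprox f γ ε (juntaSize C γ ε) r.1 (fun x => (r.2 x).run f)}) ∧
      (∀ d : ℕ, ∃ p : Polynomial ℕ,
        ∀ γ ∈ Set.Ioo (0 : ℝ) 1, ∀ ε ∈ Set.Ioo (0 : ℝ) 1, ∃ K : ℕ, ∀ n : ℕ,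
          ∃ A : RandQueryAlg n (ExplicitJunta n),
            A.QueriesAtMost (K * p.eval n) ∧
            ∀ f : Cube n → ℝ, IsMonotoneSubmodular f →
              ENNReal.ofReal (1 - 1 / ((n : ℝ) + 1) ^ d) ≤
                A.successProb f
                  {r | IsJuntaApprox f γ ε (juntaSize C γ ε) r.1 r.2}) := by
  refine ⟨juntaConst, by norm_num [juntaConst], ?_, fun d => ?_, fun d => ?_⟩
  · rintro n f hf γ ⟨hγ, hγ1⟩ ε ⟨hε, hε1⟩
    rcases Nat.eq_zero_or_pos n with rfl | hn
    · exact (learnable_of_le hγ.le hε.le (by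
        rw [Nat.cast_zero]
        exact juntaSize_nonneg hγ hγ1 hε hε1)).exists_isJuntaApprox one_pos hf
    · obtain ⟨p, hp⟩ := exists_polynomial_learnable 1
      refine (hp n γ ⟨hγ, hγ1⟩ ε ⟨hε, hε1⟩).exists_isJuntaApprox ?_ hf
      have : (0 : ℝ) < n := by exact_mod_cast hn
      rw [pow_one, div_lt_one (by linarith)]
      linarith
  · obtain ⟨p, hp⟩ := exists_polynomial_learnable d
    exact ⟨p, fun n γ hγ ε hε => hp n γ hγ ε hε⟩
  · obtain ⟨p, hp⟩ := exists_polynomial_learnable d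
    exact ⟨p, fun γ hγ ε hε => ⟨_, fun n => (hp n γ hγ ε hε).explicit⟩⟩
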